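/- Let $r\ge 1$ be an integer and $T\in\mathbb C^*$. Let $R:\widehat{\mathbb C}\to\widehat{\mathbb C}$ be a rational function of degree $r$, let $\Psi(z)=R(e^{2\pi i z/T})$, a meromorphic function $\mathbb C\to\widehat{\mathbb C}$, and let $X=f(z)\,\frac{\partial}{\partial z}$ with $f=1/\Psi'$ be the associated vector field. Put $a_0=R(0)$ and $a_\infty=R(\infty)$. Terminology. Let $D(a,\rho)$ be the disk of radius $\rho>0$ about $a\in\widehat{\mathbb C}$ in the spherical metric. A *transcendental singularity of $\Psi^{-1}$ over $a$* is a choice $U=(U(\rho))_{\rho>0}$ of a connected component $U(\rho)$ of $\Psi^{-1}(D(a,\rho))$ for each $\rho>0$ such that $U(\rho_1)\subset U(\rho_2)$ for $\rho_1<\rho_2$ and $\bigcap_{\rho>0}U(\rho)=\varnothing$. It is *logarithmic* if $\Psi:U(\rho)\to D(a,\rho)\setminus\{a\}$ is a universal covering for some $\rho>0$. An *asymptotic value* of $\Psi$ is a limit of $\Psi$ along a path tending to $\infty$. An open set $W\subset\mathbb C$ is a *hyperbolic* (resp. *elliptic*) *tract* of $X$ if, for some $c\in\mathbb R$, there is a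 biholomorphism of $W$ onto $\{\operatorname{Re}\zeta>c\}$ (resp. $\{\operatorname{Re}\zeta<c\}$) that maps $X$ to $e^{\zeta}\frac{\partial}{\partial\zeta}$. The residue of $X$ at a zero is the residue of the 1-form $dz/f(z)$. A critical point of $R$ is a point of $\widehat{\mathbb C}$ at which $R$ is not locally injective. Then: 1. $X$ is periodic of period $T$ (that is, $f(z+T)=f(z)$), and $\infty$ is the unique essential (not necessarily isolated) singularity of $X$ on $\widehat{\mathbb C}$, i.e. the unique point at which $X$ is not meromorphic. 2. The set of asymptotic values of $\Psi$ is $\{a_0,a_\infty\}$. Counted with multiplicity there are exactly two: $\Psi^{-1}$ has exactly two transcendental singularities, which are different, one over $a_0$ and one over $a_\infty$ (also when $a_0=a_\infty$). 3. Both transcendental singularities are logarithmic. Let $U$ be one of them, over $a$. - (i) If $a\in\mathbb C$, the tracts are hyperbolic: for all sufficiently small $\rho$ there is a biholomorphism of $U(\rho)$ onto $\{\zeta\in\mathbb C: a-e^{-\zeta}\in D(a,\rho)\}$ that maps $X$ to $e^\zeta\frac{\partial}{\partial\zeta}$; and for every $\rho>0$ there are $\rho'>0$ and a hyperbolic tract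 $W$ of $X$ with $U(\rho')\subset W\subset U(\rho)$. - (ii) If $a=\infty$, then $U(\rho)$ is an elliptic tract of $X$ for all sufficiently small $\rho$. 4. If $R$ has a critical point in $\widehat{\mathbb C}\setminus\{0,\infty\}$ whose critical value is finite, then $X$ has infinitely many poles, accumulating at $\infty$. 5. If $\infty$ is not an asymptotic value of $\Psi$, then $X$ has infinitely many zeros of multiplicity at least $2$ and residue zero, accumulating at $\infty$. More precisely, each pole of $R$ of order $m$ then gives rise to infinitely many zeros of $X$ of multiplicity exactly $m+1$ and residue zero, accumulating at $\infty$; in particular these are double zeros if $R$ has a simple pole. 6. The family of the rational functions $R$ of degree $r$, with its topology as a subset of $\mathbb{CP}^{2r+1}$ (coefficients of numerator and denominator up to a common factor), is the disjoint union of the four subfamilies - (i) $a_0,a_\infty,\infty$ are three distinct points; - (ii) $a_0=a_\infty\neq\infty$; - (iii) exactly one of $a_0,a_\infty$ is $\infty$; - (iv) $a_0=a_\infty=\infty$; and subfamily (i) is generic, i.e. open and dense. (Some of the subfamilies may be empty, as (ii) and (iv) are for $r=1$.) -/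

import Mathlib

open Filter Topology Set OnePoint

noncomputable section

namespace PeriodicFields

/-! ### The Riemann sphere and rational functions -/

/-- The Riemann sphere. -/
abbrev Sphere : Type := OnePoint ℂ

/-- The spherical (great circle) distance on the Riemann sphere. -/
def sphericalDist : Sphere → Sphere → ℝ
  | ∞, ∞ => 0
  | ∞, (z : ℂ) => 2 * Real.arcsin (1 / √(1 + ‖z‖ ^ 2))
  | (z : ℂ), ∞ => 2 * Real.arcsin (1 / √(1 + ‖z‖ ^ 2))
  | (z : ℂ), (w : ℂ) => 2 * Real.arcsin (‖z - w‖ / (√(1 + ‖z‖ ^ 2) * √(1 + ‖w‖ ^ 2)))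

/-- The open disk `D(a, ρ)` in the spherical metric. -/
def sphericalDisk (a : Sphere) (ρ : ℝ) : Set Sphere := {b | sphericalDist a b < ρ}

/-- The affine coordinate of a point of the sphere, with the value `0` at `∞`. -/
def affine : Sphere → ℂ
  | ∞ => 0
  | (z : ℂ) => z

/-- The map of the Riemann sphere to itself defined by a rational function
(`num` and `denom` are coprime). -/
def ratMap (R : RatFunc ℂ) : Sphere → Sphere
  | ∞ => if R.denom.natDegree < R.num.natDegree then ∞
      else ((R.num.coeff R.denom.natDegree / R.denom.leadingCoeff : ℂ) : Sphere)
  | (w : ℂ) => if R.denom.eval w = 0 then ∞ else ((R.num.eval w / R.denom.eval w : ℂ) : Sphere)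

/-- The degree of a rational function as a self-map of the sphere. -/
def ratDegree (R : RatFunc ℂ) : ℕ := max R.num.natDegree R.denom.natDegree

/-- The set of rational functions of degree `r`. -/
def RatMaps (r : ℕ) : Type := {R : RatFunc ℂ // ratDegree R = r}

/-- The polynomial `c₀ + c₁ w + ⋯ + c_r w ^ r`. -/
def coeffPoly {r : ℕ} (c : Fin (r + 1) → ℂ) : Polynomial ℂ :=
  ∑ i : Fin (r + 1), Polynomial.monomial (i : ℕ) (c i)

/-- The quotient of two polynomials given by their coefficients. -/
def coeffQuot {r : ℕ} (c : (Fin (r + 1) → ℂ) × (Fin (r + 1) → ℂ)) : RatFunc ℂ :=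
  algebraMap (Polynomial ℂ) (RatFunc ℂ) (coeffPoly c.1) /
    algebraMap (Polynomial ℂ) (RatFunc ℂ) (coeffPoly c.2)

/-- Homogeneous coordinates of the rational functions of degree `r`: the coefficient vectors
in `ℂ ^ (2 r + 2)` of numerator and denominator. -/
def RatCoeffs (r : ℕ) : Type :=
  {c : (Fin (r + 1) → ℂ) × (Fin (r + 1) → ℂ) // coeffPoly c.2 ≠ 0 ∧ ratDegree (coeffQuot c) = r}

/-- The rational functions of degree `r` are topologized as the quotient of the space of
coefficient vectors by scaling, that is, as a subset of the projective space of dimension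
`2 r + 1`. -/
instance (r : ℕ) : TopologicalSpace (RatMaps r) :=
  TopologicalSpace.coinduced (fun c : RatCoeffs r => (⟨coeffQuot c.1, c.2.2⟩ : RatMaps r))
    (instTopologicalSpaceSubtype : TopologicalSpace (RatCoeffs r))

/-! ### Functions and vector fields -/

/-- The function `Ψ(z) = R(exp(2 π i z / T))`. -/
def psi (R : RatFunc ℂ) (T : ℂ) : ℂ → Sphere := fun z =>
  ratMap R ((Complex.exp (2 * Real.pi * Complex.I * z / T) : ℂ) : Sphere)

/-- The coefficient `f = 1 / Ψ'` of the vector field `X = f(z) ∂/∂z` associated with `Ψ`.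
It is a meromorphic function; its value at its poles, and at the poles of `Ψ`, is `0`. -/
def field (Ψ : ℂ → Sphere) : ℂ → ℂ := fun z => (deriv (fun ζ => affine (Ψ ζ)) z)⁻¹

/-- The vector field `f(z) ∂/∂z` on the sphere has an essential (not necessarily isolated)
singularity at a point if it is not meromorphic there. In the coordinate `w = 1 / z` the vector
field is `- w ^ 2 f(1 / w) ∂/∂w`. -/
def IsEssentialSingularity (f : ℂ → ℂ) : Sphere → Prop
  | ∞ => ¬ MeromorphicAt (fun w => - w ^ 2 * f w⁻¹) 0
  | (z : ℂ) => ¬ MeromorphicAt f z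

/-- The poles of the vector field `f(z) ∂/∂z` in the plane. -/
def poles (f : ℂ → ℂ) : Set ℂ := {z | meromorphicOrderAt f z < 0}

/-- `g(z) dz` has residue `c` at `z₀`. -/
def HasResidue (g : ℂ → ℂ) (z₀ c : ℂ) : Prop :=
  ∀ᶠ ε in 𝓝[>] (0 : ℝ), (2 * Real.pi * Complex.I)⁻¹ * (∮ z in C(z₀, ε), g z) = c

/-- The zeros of multiplicity `k` of the vector field `f(z) ∂/∂z` in the plane at which the
1-form of time `dz / f(z)` has residue zero. -/
def residueFreeZeros (f : ℂ → ℂ) (k : ℕ) : Set ℂ :=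
  {z | meromorphicOrderAt f z = ((k : ℤ) : WithTop ℤ) ∧ HasResidue (fun ζ => (f ζ)⁻¹) z 0}

/-- Every neighborhood of `∞` contains infinitely many points of `S`. -/
def AccumulatesAtInfty (S : Set ℂ) : Prop := ∀ K : ℝ, {z ∈ S | K < ‖z‖}.Infinite

/-- A point of the plane is critical for a sphere-valued meromorphic function if the derivative
vanishes there at a finite value, or if it is a multiple pole. -/
def IsCriticalPoint (F : ℂ → Sphere) (w : ℂ) : Prop :=
  (F w ≠ ∞ ∧ deriv (fun ζ => affine (F ζ)) w = 0) ∨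
    (F w = ∞ ∧ meromorphicOrderAt (fun ζ => affine (F ζ)) w ≤ ((-2 : ℤ) : WithTop ℤ))

/-! ### Singularities of the inverse function -/

/-- `a` is the limit of `Ψ` along a path tending to `∞`. -/
def IsAsymptoticValue (Ψ : ℂ → Sphere) (a : Sphere) : Prop :=
  ∃ α : ℝ → ℂ, ContinuousOn α (Ioi 0) ∧ Tendsto α atTop (cocompact ℂ) ∧
    Tendsto (fun τ => Ψ (α τ)) atTop (𝓝 a)

/-- A transcendental singularity over `a` of the inverse of `Ψ`: a monotone choice of components
`U ρ` of the preimages of the disks `D(a, ρ)`, `ρ > 0`, with empty intersection. -/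
def IsTranscendentalSingularity (Ψ : ℂ → Sphere) (a : Sphere) (U : Ioi (0 : ℝ) → Set ℂ) : Prop :=
  (∀ ρ : Ioi (0 : ℝ), ∃ z ∈ Ψ ⁻¹' sphericalDisk a ρ, U ρ = connectedComponentIn (Ψ ⁻¹' sphericalDisk a ρ) z) ∧
    Monotone U ∧ (⋂ ρ, U ρ) = ∅

/-- `Ψ : U → V` is a universal covering. -/
def IsUniversalCovering (Ψ : ℂ → Sphere) (U : Set ℂ) (V : Set Sphere) : Prop :=
  SimplyConnectedSpace U ∧
    ∃ h : MapsTo Ψ U V, IsCoveringMap (h.restrict Ψ U V) ∧ SurjOn Ψ U V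

/-- The singularity `U` over `a` is logarithmic. -/
def IsLogarithmic (Ψ : ℂ → Sphere) (a : Sphere) (U : Ioi (0 : ℝ) → Set ℂ) : Prop :=
  ∃ ρ : Ioi (0 : ℝ), IsUniversalCovering Ψ (U ρ) (sphericalDisk a ρ \ {a})

/-- There is a biholomorphism of the plane domain `U` onto the plane domain `V` which maps the
vector field `f(z) ∂/∂z` to `g(z) ∂/∂z`. -/
def Biholomorphic (U : Set ℂ) (f : ℂ → ℂ) (V : Set ℂ) (g : ℂ → ℂ) : Prop :=
  ∃ φ : ℂ → ℂ, DifferentiableOn ℂ φ U ∧ BijOn φ U V ∧ ∀ z ∈ U, deriv φ z * f z = g (φ z)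

/-- `(W, f(z) ∂/∂z)` is biholomorphic to a right half plane with `exp(z) ∂/∂z`. -/
def IsHyperbolicTract (W : Set ℂ) (f : ℂ → ℂ) : Prop :=
  IsOpen W ∧ ∃ c : ℝ, Biholomorphic W f {ζ | c < ζ.re} Complex.exp

/-- `(W, f(z) ∂/∂z)` is biholomorphic to a left half plane with `exp(z) ∂/∂z`. -/
def IsEllipticTract (W : Set ℂ) (f : ℂ → ℂ) : Prop :=
  IsOpen W ∧ ∃ c : ℝ, Biholomorphic W f {ζ | ζ.re < c} Complex.exp

/-- The singularity `U` over the finite value `a` has hyperbolic tracts. The vector field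
`exp(z) ∂/∂z` belongs to `a - exp(-z)`. For small `ρ` the tract `U ρ` with the vector field
`f(z) ∂/∂z` is biholomorphic to the preimage of `D(a, ρ)` under `a - exp(-z)` with the vector
field `exp(z) ∂/∂z`. This preimage is not exactly a half plane, since a spherical disk is in
general not a concentric Euclidean one; the neighborhoods of the singularity which correspond
exactly to half planes are cofinal among the `U ρ`. -/
def HasHyperbolicTracts (a : ℂ) (U : Ioi (0 : ℝ) → Set ℂ) (f : ℂ → ℂ) : Prop :=
  (∃ ρ₀ : Ioi (0 : ℝ), ∀ ρ ≤ ρ₀, Biholomorphic (U ρ) f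
    {ζ | ((a - Complex.exp (-ζ) : ℂ) : Sphere) ∈ sphericalDisk (a : Sphere) ρ} Complex.exp) ∧
  ∀ ρ : Ioi (0 : ℝ), ∃ ρ' : Ioi (0 : ℝ), ∃ W : Set ℂ, U ρ' ⊆ W ∧ W ⊆ U ρ ∧ IsHyperbolicTract W f

/-- The singularity `U` (over `∞`) has elliptic tracts. -/
def HasEllipticTracts (U : Ioi (0 : ℝ) → Set ℂ) (f : ℂ → ℂ) : Prop :=
  ∃ ρ₀ : Ioi (0 : ℝ), ∀ ρ ≤ ρ₀, IsEllipticTract (U ρ) f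

/-! ### The four subfamilies -/

/-- The four configurations of the points `a₀`, `a_∞` and `∞`. -/
def Configuration (a₀ a₁ : Sphere) : Fin 4 → Prop :=
  ![a₀ ≠ a₁ ∧ a₀ ≠ ∞ ∧ a₁ ≠ ∞,
    a₀ = a₁ ∧ a₁ ≠ ∞,
    (a₀ ≠ ∞ ∧ a₁ = ∞) ∨ (a₀ = ∞ ∧ a₁ ≠ ∞),
    a₀ = ∞ ∧ a₁ = ∞]

/-- The subfamilies of the rational functions of degree `r`. -/
def subfamily (r : ℕ) (j : Fin 4) : Set (RatMaps r) :=
  {R | Configuration (ratMap R.1 ((0 : ℂ) : Sphere)) (ratMap R.1 ∞) j}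

end PeriodicFields

end

noncomputable section

namespace PeriodicFields

/-!
Put `l = 2 π i / T`. The function `Ψ` is rational in `w = exp(l z)` and also in `w⁻¹`, so that the
two ends of the cylinder `ℂ / T ℤ` play the same role. At the end `w → 0` write
`R(w) - a₀ = w ^ k u(w)` (or `1 / R(w) = w ^ k u(w)` if `a₀ = ∞`) with `u(0) ≠ 0`. Up to sign, the
coordinate `φ(z) = k l z + log u(exp(l z))` turns `Ψ` into `a₀ - exp(ζ)` (or `exp(-ζ)`) on a region
which covers a left half plane. This exhibits a logarithmic singularity and its tracts.

There are no other singularities or asymptotic values. Choose two circles about `w = 0`, joined by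
a radial segment, on which `R` does not take the value `a`. The preimage of a small disk about `a`
avoids the preimage of this barrier under `exp(l z)`, and therefore each unbounded connected piece
of it lies in one of the two ends.

Poles and zeros of the vector field come from critical points and poles of `R` at `w ≠ 0`, and
repeat with period `T`. In the space of rational functions, a small translation of the argument
makes `a₀` and `a_∞` different, and then a small Möbius transformation of the values makes both of
them finite.
-/

/-! ### The spherical metric -/

lemma comap_coe_nhds_infty_eq_cobounded :
    comap ((↑) : ℂ → Sphere) (𝓝 ∞) = Bornology.cobounded ℂ := by
  rw [OnePoint.comap_coe_nhds_infty, coclosedCompact_eq_cocompact, Metric.cobounded_eq_cocompact]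

lemma tendsto_coe_cobounded : Tendsto ((↑) : ℂ → Sphere) (Bornology.cobounded ℂ) (𝓝 ∞) :=
  tendsto_iff_comap.2 comap_coe_nhds_infty_eq_cobounded.ge

lemma continuous_iff_tendsto_cobounded {Y : Type*} [TopologicalSpace Y] {F : Sphere → Y} :
    Continuous F ↔ Tendsto (fun z : ℂ => F z) (Bornology.cobounded ℂ) (𝓝 (F ∞)) ∧
      Continuous fun z : ℂ => F z := by
  rw [OnePoint.continuous_iff, coclosedCompact_eq_cocompact, Metric.cobounded_eq_cocompact]

lemma sphericalDist_coe_coe (z w : ℂ) : sphericalDist (z : Sphere) (w : Sphere) =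
    2 * Real.arcsin (‖z - w‖ / (√(1 + ‖z‖ ^ 2) * √(1 + ‖w‖ ^ 2))) := rfl

lemma sphericalDist_coe_infty (z : ℂ) : sphericalDist (z : Sphere) ∞ =
    2 * Real.arcsin (1 / √(1 + ‖z‖ ^ 2)) := rfl

lemma sphericalDist_infty_coe (z : ℂ) : sphericalDist ∞ (z : Sphere) =
    2 * Real.arcsin (1 / √(1 + ‖z‖ ^ 2)) := rfl

lemma sphericalDist_infty_infty : sphericalDist ∞ ∞ = 0 := rfl

lemma sphericalDist_self (a : Sphere) : sphericalDist a a = 0 := by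
  induction a using OnePoint.rec with
  | infty => rfl
  | coe z => simp [sphericalDist_coe_coe]

lemma sphericalDist_pos {a b : Sphere} (h : a ≠ b) : 0 < sphericalDist a b := by
  induction a using OnePoint.rec <;> induction b using OnePoint.rec
  case infty.infty => exact absurd rfl h
  case infty.coe w => exact mul_pos two_pos (Real.arcsin_pos.2 (by positivity))
  case coe.infty z => exact mul_pos two_pos (Real.arcsin_pos.2 (by positivity))
  case coe.coe z w =>
    have hzw : 0 < ‖z - w‖ := norm_pos_iff.2 (sub_ne_zero.2 fun hzw => h (congrArg _ hzw))
    exact mul_pos two_pos (Real.arcsin_pos.2 (by positivity))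

lemma sqrt_one_add_norm_sq_eq {𝕜 : Type*} [NormedDivisionRing 𝕜] {w : 𝕜} (hw : w ≠ 0) :
    √(1 + ‖w‖ ^ 2) = ‖w‖ * √(1 + ‖w⁻¹‖ ^ 2) := by
  have h : 0 < ‖w‖ := norm_pos_iff.2 hw
  rw [← Real.sqrt_sq h.le, ← Real.sqrt_mul (by positivity), Real.sqrt_sq h.le, norm_inv]
  congr 1
  field_simp
  ring

lemma tendsto_norm_sub_mul_div_sqrt_cobounded {𝕜 : Type*} [NormedField 𝕜] (u z : 𝕜) :
    Tendsto (fun w => ‖u - z * w‖ / √(1 + ‖w‖ ^ 2)) (Bornology.cobounded 𝕜) (𝓝 ‖z‖) := by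
  have hcont : Continuous fun s : 𝕜 => ‖u * s - z‖ / √(1 + ‖s‖ ^ 2) :=
    Continuous.div (by fun_prop) (by fun_prop) fun s => by positivity
  have hlim := (hcont.tendsto 0).comp tendsto_inv₀_cobounded
  simp only [mul_zero, zero_sub, norm_neg, norm_zero, ne_eq, OfNat.ofNat_ne_zero,
    not_false_eq_true, zero_pow, add_zero, Real.sqrt_one, div_one] at hlim
  refine hlim.congr' ?_
  filter_upwards [Bornology.eventually_ne_cobounded 0] with w hw
  have hnorm : ‖u * w⁻¹ - z‖ = ‖u - z * w‖ / ‖w‖ := by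
    rw [← norm_div]
    congr 1
    field_simp
  rw [Function.comp_apply, sqrt_one_add_norm_sq_eq hw, hnorm, div_div]

lemma continuous_sphericalDist_infty : Continuous (sphericalDist ∞) := by
  refine continuous_iff_tendsto_cobounded.2 ⟨?_, ?_⟩
  · have hlim := tendsto_norm_sub_mul_div_sqrt_cobounded (1 : ℂ) 0
    simp only [zero_mul, sub_zero, norm_one, norm_zero] at hlim
    simpa [sphericalDist_infty_coe, sphericalDist_infty_infty] using
      ((Real.continuous_arcsin.tendsto 0).comp hlim).const_mul 2
  · exact continuous_const.mul (Real.continuous_arcsin.comp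
      (continuous_const.div (by fun_prop) fun w => by positivity))

lemma continuous_sphericalDist_coe (z : ℂ) : Continuous (sphericalDist z) := by
  refine continuous_iff_tendsto_cobounded.2 ⟨?_, ?_⟩
  · have hlim := (tendsto_norm_sub_mul_div_sqrt_cobounded z 1).div_const √(1 + ‖z‖ ^ 2)
    simp only [one_mul, norm_one, div_div] at hlim
    refine (((Real.continuous_arcsin.tendsto _).comp hlim).const_mul 2).congr fun w => ?_
    rw [sphericalDist_coe_coe, Function.comp_apply, mul_comm √(1 + ‖w‖ ^ 2)]
  · exact continuous_const.mul (Real.continuous_arcsin.comp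
      (Continuous.div (by fun_prop) (by fun_prop) fun w => by positivity))

lemma continuous_sphericalDist (a : Sphere) : Continuous (sphericalDist a) := by
  induction a using OnePoint.rec with
  | infty => exact continuous_sphericalDist_infty
  | coe z => exact continuous_sphericalDist_coe z

lemma isOpen_sphericalDisk (a : Sphere) (ρ : ℝ) : IsOpen (sphericalDisk a ρ) :=
  isOpen_lt (continuous_sphericalDist a) continuous_const

lemma mem_sphericalDisk_self (a : Sphere) {ρ : ℝ} (hρ : 0 < ρ) : a ∈ sphericalDisk a ρ := by
  rwa [sphericalDisk, mem_ofPred_eq, sphericalDist_self]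

lemma sphericalDisk_mono (a : Sphere) : Monotone (sphericalDisk a) :=
  fun _ _ hρ _ hb => lt_of_lt_of_le hb hρ

lemma sphericalDisk_mem_nhds (a : Sphere) {ρ : ℝ} (hρ : 0 < ρ) : sphericalDisk a ρ ∈ 𝓝 a :=
  (isOpen_sphericalDisk a ρ).mem_nhds (mem_sphericalDisk_self a hρ)

lemma nhds_hasBasis_sphericalDisk (a : Sphere) :
    (𝓝 a).HasBasis (fun ρ : ℝ => 0 < ρ) (sphericalDisk a) := by
  refine ⟨fun V => ⟨fun hV => ?_, fun ⟨ρ, hρ, hsub⟩ =>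
    mem_of_superset (sphericalDisk_mem_nhds a hρ) hsub⟩⟩
  obtain ⟨W, hWV, hW, haW⟩ := mem_nhds_iff.1 hV
  rcases Wᶜ.eq_empty_or_nonempty with hempty | hne
  · exact ⟨1, one_pos, fun b _ => hWV (compl_empty_iff.1 hempty ▸ mem_univ b)⟩
  · obtain ⟨b, hb, hmin⟩ := hW.isClosed_compl.isCompact.exists_isMinOn hne
      (continuous_sphericalDist a).continuousOn
    refine ⟨sphericalDist a b, sphericalDist_pos fun h => hb (h ▸ haW), fun c hc => ?_⟩
    by_contra hcV
    exact not_le.2 hc (isMinOn_iff.1 hmin c fun h => hcV (hWV h))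

lemma eq_of_forall_mem_sphericalDisk {a b : Sphere} (h : ∀ ρ > 0, b ∈ sphericalDisk a ρ) :
    b = a := by
  by_contra hne
  have hlt : sphericalDist a b < sphericalDist a b := h _ (sphericalDist_pos (Ne.symm hne))
  exact lt_irrefl _ hlt

lemma two_mul_arcsin_lt_iff {ρ : ℝ} (h0 : 0 < ρ) (hπ : ρ ≤ Real.pi) (x : ℝ) :
    2 * Real.arcsin x < ρ ↔ x < Real.sin (ρ / 2) := by
  rw [← Real.arcsin_lt_iff_lt_sin' ⟨by linarith [Real.pi_pos], by linarith⟩, lt_div_iff₀' two_pos]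

lemma coe_mem_sphericalDisk_coe {ρ : ℝ} (h0 : 0 < ρ) (hπ : ρ ≤ Real.pi) (z w : ℂ) :
    (w : Sphere) ∈ sphericalDisk (z : Sphere) ρ ↔
      ‖z - w‖ ^ 2 < Real.sin (ρ / 2) ^ 2 * ((1 + ‖z‖ ^ 2) * (1 + ‖w‖ ^ 2)) := by
  have hs : 0 < Real.sin (ρ / 2) := Real.sin_pos_of_pos_of_lt_pi (by linarith) (by linarith)
  rw [sphericalDisk, mem_ofPred_eq, sphericalDist_coe_coe, two_mul_arcsin_lt_iff h0 hπ,
    div_lt_iff₀ (by positivity), ← sq_lt_sq₀ (by positivity) (by positivity), mul_pow, mul_pow,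
    Real.sq_sqrt (by positivity), Real.sq_sqrt (by positivity)]

lemma coe_mem_sphericalDisk_infty {ρ : ℝ} (h0 : 0 < ρ) (hπ : ρ ≤ Real.pi) (w : ℂ) :
    (w : Sphere) ∈ sphericalDisk ∞ ρ ↔ 1 / Real.sin (ρ / 2) ^ 2 - 1 < ‖w‖ ^ 2 := by
  have hs : 0 < Real.sin (ρ / 2) := Real.sin_pos_of_pos_of_lt_pi (by linarith) (by linarith)
  rw [sphericalDisk, mem_ofPred_eq, sphericalDist_infty_coe, two_mul_arcsin_lt_iff h0 hπ,
    div_lt_comm₀ (by positivity) hs, ← sq_lt_sq₀ (by positivity) (by positivity),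
    Real.sq_sqrt (by positivity), div_pow, one_pow, sub_lt_iff_lt_add']

lemma eventually_sphericalDisk_subset {a : Sphere} {V : Set Sphere} (hV : V ∈ 𝓝 a) :
    ∀ᶠ ρ in 𝓝[>] (0 : ℝ), sphericalDisk a ρ ⊆ V := by
  obtain ⟨ρ₀, hρ₀, hsub⟩ := (nhds_hasBasis_sphericalDisk a).mem_iff.1 hV
  filter_upwards [Ioo_mem_nhdsGT hρ₀] with ρ hρ
  exact (sphericalDisk_mono a hρ.2.le).trans hsub

/-! ### Quotients of two polynomials as maps to the sphere -/

section Polynomial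

open Polynomial

lemma eventually_nhdsNE_eval_ne_zero {R : Type*} [CommRing R] [IsDomain R] [TopologicalSpace R]
    [T1Space R] {p : R[X]} (hp : p ≠ 0) (w : R) : ∀ᶠ v in 𝓝[≠] w, p.eval v ≠ 0 := by
  have hfin : {v | p.IsRoot v}.Finite := finite_setOfPred_isRoot hp
  have hmem : ({v | p.IsRoot v} \ {w})ᶜ ∈ 𝓝 w :=
    (hfin.subset sdiff_subset).isClosed.isOpen_compl.mem_nhds (by simp)
  filter_upwards [mem_nhdsWithin_of_mem_nhds hmem, self_mem_nhdsWithin] with v hv hvw h0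
  exact hv ⟨h0, hvw⟩

lemma eval_zero_reflect {R : Type*} [Semiring R] (r : ℕ) (p : R[X]) :
    (p.reflect r).eval 0 = p.coeff r := by
  rw [← coeff_zero_eq_eval_zero, coeff_reflect, revAt_le (Nat.zero_le r), Nat.sub_zero]

lemma eval_reflect_inv_mul_pow {K : Type*} [Field K] {r : ℕ} {p : K[X]} (hp : p.natDegree ≤ r)
    {w : K} (hw : w ≠ 0) : (p.reflect r).eval w⁻¹ * w ^ r = p.eval w := by
  let := invertibleOfNonzero hw
  simpa [invOf_eq_inv, eval₂_id] using eval₂_reflect_mul_pow (RingHom.id K) w r p hp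

lemma tendsto_div_cobounded {α 𝕜 : Type*} [NormedField 𝕜] {F : Filter α} {f g : α → 𝕜} {c : 𝕜}
    (hc : c ≠ 0) (hf : Tendsto f F (𝓝 c)) (hg : Tendsto g F (𝓝[≠] 0)) :
    Tendsto (fun x => f x / g x) F (Bornology.cobounded 𝕜) := by
  have hdiv : Tendsto (fun x => g x / f x) F (𝓝[≠] 0) := by
    refine tendsto_nhdsWithin_iff.2 ⟨?_, ?_⟩
    · exact zero_div c ▸ (tendsto_nhds_of_tendsto_nhdsWithin hg).div hf hc
    · filter_upwards [hf.eventually_ne hc, (tendsto_nhdsWithin_iff.1 hg).2] with x hfx hgx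
      exact div_ne_zero hgx hfx
  exact (tendsto_inv₀_nhdsNE_zero.comp hdiv).congr fun x => inv_div _ _

/-- The polynomials `N` and `D` are coprime and linearly independent, that is, they are the
numerator and the denominator of a nonconstant rational function in lowest terms. -/
structure NonconstantPair {K : Type*} [Field K] (N D : K[X]) : Prop where
  isCoprime : IsCoprime N D
  linearIndependent : LinearIndependent K ![N, D]

namespace NonconstantPair

section Field

variable {K : Type*} [Field K] {N D : K[X]}

lemma of_isCoprime (h : IsCoprime N D) (hr : 1 ≤ max N.natDegree D.natDegree) :
    NonconstantPair N D := by
  refine ⟨h, LinearIndependent.pair_iff.2 fun s t hst => ?_⟩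
  have hs : s = 0 := by
    by_contra hs
    have hN : N = C (-t / s) * D := by
      rw [← smul_eq_C_mul, neg_div, neg_smul, eq_neg_iff_add_eq_zero, div_eq_inv_mul, mul_smul,
        ← inv_smul_smul₀ hs N, ← smul_add, hst, smul_zero]
    have hD : D.natDegree = 0 :=
      natDegree_eq_zero_of_isUnit (h.isUnit_of_dvd' (hN ▸ dvd_mul_left _ _) dvd_rfl)
    have hle : N.natDegree ≤ D.natDegree := hN ▸ natDegree_C_mul_le _ D
    omega
  refine ⟨hs, by_contra fun ht => ?_⟩
  rw [hs, zero_smul, zero_add, smul_eq_zero_iff_right ht] at hst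
  rw [hst, isCoprime_zero_right] at h
  simp [hst, natDegree_eq_zero_of_isUnit h] at hr

variable (h : NonconstantPair N D)
include h

lemma denom_ne_zero : D ≠ 0 := h.linearIndependent.ne_zero 1

lemma sub_ne_zero (b : K) : N - C b * D ≠ 0 := fun h0 => by
  have h1 := (LinearIndependent.pair_iff.1 h.linearIndependent 1 (-b) (by
    rw [one_smul, neg_smul, smul_eq_C_mul, ← sub_eq_add_neg, h0])).1
  exact one_ne_zero h1

lemma eval_ne_zero {w : K} (hw : D.eval w = 0) : N.eval w ≠ 0 := fun hN => by
  obtain ⟨p, q, hpq⟩ := h.isCoprime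
  simpa [hw, hN] using congrArg (eval w) hpq

lemma derivative_mul_sub_ne_zero [CharZero K] :
    derivative N * D - N * derivative D ≠ 0 := fun h0 => by
  have hwronskian : N.wronskian D = 0 := by rw [wronskian, ← neg_eq_zero, neg_sub, h0]
  obtain ⟨hN, hD⟩ := h.isCoprime.wronskian_eq_zero_iff.1 hwronskian
  rw [derivative_eq_zero] at hN hD
  have hDC := eq_C_of_natDegree_eq_zero hD
  have hzero := LinearIndependent.pair_iff.1 h.linearIndependent (D.coeff 0) (-N.coeff 0) (by
    rw [eq_C_of_natDegree_eq_zero hN, hDC]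
    simp [smul_C, mul_comm])
  exact h.denom_ne_zero (by rw [hDC, hzero.1, C_0])

lemma reflect [IsAlgClosed K] :
    NonconstantPair (N.reflect (max N.natDegree D.natDegree))
      (D.reflect (max N.natDegree D.natDegree)) := by
  set r := max N.natDegree D.natDegree with hr
  refine ⟨(isCoprime_iff_aeval_ne_zero_of_isAlgClosed K K _ _).2 fun w => ?_,
    LinearIndependent.pair_iff.2 fun s t hst => ?_⟩
  · change eval w _ ≠ 0 ∨ eval w _ ≠ 0
    rcases eq_or_ne w 0 with rfl | hw
    · rw [eval_zero_reflect, eval_zero_reflect]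
      rcases max_choice N.natDegree D.natDegree with hm | hm
      · exact .inl (by rw [hr, hm]; exact leadingCoeff_ne_zero.2 (h.linearIndependent.ne_zero 0))
      · exact .inr (by rw [hr, hm]; exact leadingCoeff_ne_zero.2 h.denom_ne_zero)
    · have hN := eval_reflect_inv_mul_pow (le_max_left N.natDegree D.natDegree) (inv_ne_zero hw)
      have hD := eval_reflect_inv_mul_pow (le_max_right N.natDegree D.natDegree) (inv_ne_zero hw)
      rw [inv_inv] at hN hD
      by_contra! h0
      rw [h0.1, zero_mul] at hN
      rw [h0.2, zero_mul] at hD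
      exact h.eval_ne_zero hD.symm hN.symm
  · rw [smul_eq_C_mul, smul_eq_C_mul, ← reflect_C_mul, ← reflect_C_mul, ← reflect_add,
      reflect_eq_zero_iff, ← smul_eq_C_mul, ← smul_eq_C_mul] at hst
    exact LinearIndependent.pair_iff.1 h.linearIndependent s t hst

end Field

end NonconstantPair

/-- The point of the sphere with homogeneous coordinates `[a : b]`. It has this meaning only if `a`
and `b` do not both vanish. -/
def projPoint (a b : ℂ) : Sphere := if b = 0 then ∞ else ((a / b : ℂ) : Sphere)

lemma projPoint_eq_infty_iff {a b : ℂ} : projPoint a b = ∞ ↔ b = 0 := by simp [projPoint]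

lemma projPoint_mul_right (a b : ℂ) {k : ℂ} (hk : k ≠ 0) :
    projPoint (a * k) (b * k) = projPoint a b := by
  simp [projPoint, hk, mul_div_mul_right]

lemma projPoint_eq_projPoint_iff {a b c d : ℂ} (hb : b ≠ 0) (hd : d ≠ 0) :
    projPoint a b = projPoint c d ↔ a * d = c * b := by
  rw [projPoint, projPoint, if_neg hb, if_neg hd, OnePoint.coe_eq_coe, div_eq_div_iff hb hd]

/-- The quotient of the coprime polynomials `N` and `D` as a map to the sphere. -/
def pairMap (N D : ℂ[X]) (w : ℂ) : Sphere := projPoint (N.eval w) (D.eval w)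

lemma affine_coe (z : ℂ) : affine (z : Sphere) = z := rfl

section PairMap

variable {N D : ℂ[X]}

lemma ratMap_coe (R : RatFunc ℂ) (w : ℂ) : ratMap R (w : Sphere) = pairMap R.num R.denom w := rfl

lemma pairMap_of_eval_eq_zero {w : ℂ} (h : D.eval w = 0) : pairMap N D w = ∞ := if_pos h

lemma pairMap_of_eval_ne_zero {w : ℂ} (h : D.eval w ≠ 0) :
    pairMap N D w = ((N.eval w / D.eval w : ℂ) : Sphere) := if_neg h

lemma pairMap_eq_infty_iff {w : ℂ} : pairMap N D w = ∞ ↔ D.eval w = 0 :=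
  projPoint_eq_infty_iff

lemma pairMap_eq_coe_iff {w b : ℂ} :
    pairMap N D w = b ↔ D.eval w ≠ 0 ∧ N.eval w = b * D.eval w := by
  by_cases hD : D.eval w = 0
  · simp [pairMap_of_eval_eq_zero hD, hD]
  · rw [pairMap_of_eval_ne_zero hD, OnePoint.coe_eq_coe, div_eq_iff hD, and_iff_right hD]

lemma affine_pairMap (w : ℂ) : affine (pairMap N D w) = N.eval w / D.eval w := by
  by_cases h : D.eval w = 0
  · rw [pairMap_of_eval_eq_zero h, h, div_zero]; rfl
  · rw [pairMap_of_eval_ne_zero h, affine_coe]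

lemma NonconstantPair.tendsto_eval_div_cobounded (h : NonconstantPair N D) {w : ℂ}
    (hw : D.eval w = 0) :
    Tendsto (fun v => N.eval v / D.eval v) (𝓝[≠] w) (Bornology.cobounded ℂ) := by
  refine tendsto_div_cobounded (h.eval_ne_zero hw) (N.continuous.continuousAt.mono_left
    nhdsWithin_le_nhds) (tendsto_nhdsWithin_iff.2 ⟨?_, eventually_nhdsNE_eval_ne_zero
      h.denom_ne_zero w⟩)
  exact hw ▸ D.continuous.continuousAt.mono_left nhdsWithin_le_nhds

lemma NonconstantPair.continuous_pairMap (h : NonconstantPair N D) :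
    Continuous (pairMap N D) := by
  refine continuous_iff_continuousAt.2 fun w => continuousAt_iff_punctured_nhds.2 ?_
  have hev : ∀ᶠ v in 𝓝[≠] w, ((N.eval v / D.eval v : ℂ) : Sphere) = pairMap N D v := by
    filter_upwards [eventually_nhdsNE_eval_ne_zero h.denom_ne_zero w] with v hv
    exact (pairMap_of_eval_ne_zero hv).symm
  by_cases hw : D.eval w = 0
  · rw [pairMap_of_eval_eq_zero hw]
    exact (tendsto_coe_cobounded.comp (h.tendsto_eval_div_cobounded hw)).congr' hev
  · rw [pairMap_of_eval_ne_zero hw]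
    exact ((OnePoint.continuous_coe.continuousAt.comp (N.continuous.continuousAt.div
      D.continuous.continuousAt hw)).mono_left nhdsWithin_le_nhds).congr' hev

lemma NonconstantPair.finite_setOf_pairMap_eq (h : NonconstantPair N D) (a : Sphere) :
    {w | pairMap N D w = a}.Finite := by
  induction a using OnePoint.rec with
  | infty => exact (finite_setOfPred_isRoot h.denom_ne_zero).subset fun w => pairMap_eq_infty_iff.1
  | coe b =>
    refine (finite_setOfPred_isRoot (h.sub_ne_zero b)).subset fun w hw => ?_
    simp [IsRoot, (pairMap_eq_coe_iff.1 hw).2]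

lemma NonconstantPair.num_denom {R : RatFunc ℂ} (hR : 1 ≤ ratDegree R) :
    NonconstantPair R.num R.denom := of_isCoprime (RatFunc.isCoprime_num_denom R) hR

lemma pairMap_reflect_inv {r : ℕ} (hN : N.natDegree ≤ r) (hD : D.natDegree ≤ r) {w : ℂ}
    (hw : w ≠ 0) : pairMap (N.reflect r) (D.reflect r) w⁻¹ = pairMap N D w := by
  rw [pairMap, pairMap, ← eval_reflect_inv_mul_pow hN hw, ← eval_reflect_inv_mul_pow hD hw,
    projPoint_mul_right _ _ (pow_ne_zero r hw)]

lemma ratMap_zero (R : RatFunc ℂ) :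
    ratMap R ((0 : ℂ) : Sphere) = projPoint (R.num.coeff 0) (R.denom.coeff 0) := by
  rw [ratMap_coe, pairMap, coeff_zero_eq_eval_zero, coeff_zero_eq_eval_zero]

lemma ratMap_infty (R : RatFunc ℂ) :
    ratMap R ∞ = projPoint (R.num.coeff (ratDegree R)) (R.denom.coeff (ratDegree R)) := by
  rw [ratDegree, projPoint]
  change (if R.denom.natDegree < R.num.natDegree then ∞
      else ((R.num.coeff R.denom.natDegree / R.denom.leadingCoeff : ℂ) : Sphere)) = _
  by_cases h : R.denom.natDegree < R.num.natDegree
  · rw [if_pos h, max_eq_left h.le, if_pos (coeff_eq_zero_of_natDegree_lt h)]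
  · rw [if_neg h, max_eq_right (not_lt.1 h), coeff_natDegree,
      if_neg (leadingCoeff_ne_zero.2 (RatFunc.denom_ne_zero R))]

lemma pairMap_reflect_zero (r : ℕ) (N D : ℂ[X]) :
    pairMap (N.reflect r) (D.reflect r) 0 = projPoint (N.coeff r) (D.coeff r) := by
  rw [pairMap, eval_zero_reflect, eval_zero_reflect]

end PairMap

end Polynomial

/-! ### Logarithmic coordinates on half planes -/

lemma exists_fixedPoint_of_lipschitzOnWith {α : Type*} [MetricSpace α] {s : Set α}
    (hs : IsComplete s) (hne : s.Nonempty) {F : α → α} (hmaps : MapsTo F s s) {K : NNReal}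
    (hK : K < 1) (hF : LipschitzOnWith K F s) : ∃ u ∈ s, F u = u := by
  obtain ⟨x, hx⟩ := hne
  have hcontr : ContractingWith K (hmaps.restrict F s s) := ⟨hK, hF.mapsToRestrict hmaps⟩
  obtain ⟨u, hu, hfix, -⟩ := hcontr.exists_fixedPoint' hs hmaps hx (edist_ne_top _ _)
  exact ⟨u, hu, hfix⟩

lemma ne_zero_of_hasDerivAt_of_antilipschitzWith {𝕜 E : Type*} [NontriviallyNormedField 𝕜]
    [NormedAddCommGroup E] [NormedSpace 𝕜 E] {f : 𝕜 → E} {f' : E} {z : 𝕜} (hf : HasDerivAt f f' z)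
    {s : Set 𝕜} (hs : s ∈ 𝓝 z) {K : NNReal} (hK : AntilipschitzWith K (s.domRestrict f)) :
    f' ≠ 0 := by
  rintro rfl
  have hlittle : (fun w => f w - f z) =o[𝓝 z] fun w => w - z := by
    simpa using hasDerivAt_iff_isLittleO.1 hf
  have hbig : (fun w => w - z) =O[𝓝 z] fun w => f w - f z := by
    refine .of_bound K ?_
    filter_upwards [hs] with w hw
    simpa [dist_eq_norm, Subtype.dist_eq] using
      hK.le_mul_dist ⟨w, hw⟩ ⟨z, mem_of_mem_nhds hs⟩
  have hne : ∃ᶠ w in 𝓝 z, w - z ≠ 0 :=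
    (eventually_mem_nhdsWithin.mono fun w hw => sub_ne_zero.2 hw : ∀ᶠ w in 𝓝[≠] z, _).frequently
      |>.filter_mono nhdsWithin_le_nhds
  exact Asymptotics.isLittleO_irrefl hne (hbig.trans_isLittleO hlittle)

/-- A conformal coordinate `φ` on the open set `H` whose image contains the half plane
`Re ζ < c`. The condition on the closure says that the part of `H` over this half plane is bounded
away from the boundary of `H`, and so is a full component of the preimage. -/
structure HalfPlaneChart (φ : ℂ → ℂ) (H : Set ℂ) (c : ℝ) : Prop where
  isOpen : IsOpen H
  differentiableOn : DifferentiableOn ℂ φ H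
  antilipschitz : ∃ K : NNReal, AntilipschitzWith K (H.domRestrict φ)
  surjOn : SurjOn φ H {ζ | ζ.re < c}
  closure_subset : closure (H ∩ φ ⁻¹' {ζ | ζ.re < c}) ⊆ H

namespace HalfPlaneChart

variable {φ : ℂ → ℂ} {H : Set ℂ} {c : ℝ} (E : HalfPlaneChart φ H c)
include E

lemma injOn : InjOn φ H := by
  obtain ⟨K, hK⟩ := E.antilipschitz
  exact injOn_iff_injective.2 hK.injective

lemma differentiableAt {z : ℂ} (hz : z ∈ H) : DifferentiableAt ℂ φ z :=
  E.differentiableOn.differentiableAt (E.isOpen.mem_nhds hz)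

lemma deriv_ne_zero {z : ℂ} (hz : z ∈ H) : deriv φ z ≠ 0 := by
  obtain ⟨K, hK⟩ := E.antilipschitz
  exact ne_zero_of_hasDerivAt_of_antilipschitzWith (E.differentiableAt hz).hasDerivAt
    (E.isOpen.mem_nhds hz) hK

lemma comp_const_mul {l : ℂ} (hl : l ≠ 0) :
    HalfPlaneChart (fun z => φ (l * z)) ((l * ·) ⁻¹' H) c where
  isOpen := E.isOpen.preimage (continuous_const_mul l)
  differentiableOn := E.differentiableOn.comp (by fun_prop) fun _ => id
  antilipschitz := by
    obtain ⟨K, hK⟩ := E.antilipschitz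
    refine ⟨‖l‖₊⁻¹ * K, .of_le_mul_dist fun z w => ?_⟩
    have hlip := hK.le_mul_dist ⟨l * z, z.2⟩ ⟨l * w, w.2⟩
    have hl' : 0 < ‖l‖ := norm_pos_iff.2 hl
    simp only [Subtype.dist_eq, dist_eq_norm, ← mul_sub, norm_mul] at hlip ⊢
    push_cast
    rwa [mul_assoc, ← div_eq_inv_mul, le_div_iff₀' hl']
  surjOn := fun ζ hζ => by
    obtain ⟨u, hu, rfl⟩ := E.surjOn hζ
    have hlu : l * (u / l) = u := mul_div_cancel₀ u hl
    exact ⟨u / l, by rwa [mem_preimage, hlu], congrArg φ hlu⟩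
  closure_subset := ((continuous_const_mul l).closure_preimage_subset
    (H ∩ φ ⁻¹' {ζ | ζ.re < c})).trans (preimage_mono E.closure_subset)

end HalfPlaneChart

section PerturbedDilation

variable {g : ℂ → ℂ} {k : ℕ} {K : NNReal} {c c' B : ℝ}

lemma exists_natCast_mul_add_eq (hK : K < k) (hg : LipschitzOnWith K g {u | u.re < c})
    (hB : ∀ u : ℂ, u.re < c → ‖g u‖ ≤ B) (hc : c' < c) {ζ : ℂ} (hζ : ζ.re ≤ k * c' - B) :
    ∃ u : ℂ, u.re < c ∧ k * u + g u = ζ := by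
  have hk : (0 : ℝ) < k := K.2.trans_lt (by exact_mod_cast hK)
  have hsub : {u : ℂ | u.re ≤ c'} ⊆ {u | u.re < c} := fun u hu => lt_of_le_of_lt hu hc
  have hmaps : MapsTo (fun u => (ζ - g u) / k) {u : ℂ | u.re ≤ c'} {u | u.re ≤ c'} := by
    intro u hu
    have hre := (abs_le.1 ((Complex.abs_re_le_norm (g u)).trans (hB u (hsub hu)))).1
    rw [mem_ofPred_eq, Complex.div_natCast_re, Complex.sub_re, div_le_iff₀' hk]
    linarith
  have hlip : LipschitzOnWith (K / k) (fun u => (ζ - g u) / k) {u : ℂ | u.re ≤ c'} := by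
    refine .of_dist_le_mul fun u hu v hv => ?_
    have huv := hg.dist_le_mul u (hsub hu) v (hsub hv)
    rw [dist_eq_norm, ← sub_div, sub_sub_sub_cancel_left, norm_div, Complex.norm_natCast,
      ← dist_eq_norm, dist_comm, NNReal.coe_div, NNReal.coe_natCast, div_mul_eq_mul_div]
    gcongr
  obtain ⟨u, hu, hfix⟩ := exists_fixedPoint_of_lipschitzOnWith
    (isClosed_le Complex.continuous_re continuous_const).isComplete ⟨(c' : ℂ), by simp⟩ hmaps
    (by rwa [div_lt_one (by exact_mod_cast hk)]) hlip
  rw [div_eq_iff (by exact_mod_cast hk.ne')] at hfix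
  exact ⟨u, hsub hu, by linear_combination -hfix⟩

lemma antilipschitzWith_natCast_mul_add {s : Set ℂ} (hK : K < k) (hg : LipschitzOnWith K g s) :
    AntilipschitzWith ((k : NNReal)⁻¹⁻¹ - K)⁻¹ (s.domRestrict fun u => k * u + g u) := by
  have hmul : AntilipschitzWith (k : NNReal)⁻¹ (s.domRestrict fun u : ℂ => k * u) := by
    have hk : (0 : ℝ) < k := K.2.trans_lt (by exact_mod_cast hK)
    refine .of_le_mul_dist fun u v => le_of_eq ?_
    simp only [domRestrict_apply, Subtype.dist_eq, dist_eq_norm, ← mul_sub, norm_mul,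
      Complex.norm_natCast]
    push_cast
    rw [inv_mul_cancel_left₀ hk.ne']
  exact hmul.add_lipschitzWith hg.to_restrict (by rwa [inv_inv])

lemma halfPlaneChart_natCast_mul_add (hK : K < k) (hg : LipschitzOnWith K g {u | u.re < c})
    (hd : DifferentiableOn ℂ g {u | u.re < c}) (hB : ∀ u : ℂ, u.re < c → ‖g u‖ ≤ B)
    (hc : c' < c) : HalfPlaneChart (fun u => k * u + g u) {u | u.re < c} (k * c' - B) where
  isOpen := isOpen_lt Complex.continuous_re continuous_const
  differentiableOn := by fun_prop
  antilipschitz := ⟨_, antilipschitzWith_natCast_mul_add hK hg⟩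
  surjOn := fun _ hζ => exists_natCast_mul_add_eq hK hg hB hc (le_of_lt hζ)
  closure_subset := by
    have hk : (0 : ℝ) < k := K.2.trans_lt (by exact_mod_cast hK)
    refine (closure_minimal (t := {u : ℂ | u.re ≤ c'}) (fun u hu => ?_)
      (isClosed_le Complex.continuous_re continuous_const)).trans fun u hu => lt_of_le_of_lt hu hc
    have hre := (abs_le.1 ((Complex.abs_re_le_norm (g u)).trans (hB u hu.1))).1
    have hφ : k * u.re + (g u).re < k * c' - B := by simpa using hu.2
    exact le_of_mul_le_mul_left (by linarith) hk

end PerturbedDilation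

lemma eventually_atBot_forall_re_lt {p : ℂ → Prop} (hp : ∀ᶠ w in 𝓝 0, p w) :
    ∀ᶠ c : ℝ in atBot, ∀ u : ℂ, u.re < c → p (Complex.exp u) := by
  have hexp : ∀ᶠ u in comap Complex.re atBot, p (Complex.exp u) :=
    Complex.comap_exp_nhds_zero ▸ hp.comap Complex.exp
  obtain ⟨c₀, hc₀⟩ := eventually_atBot.1 (eventually_comap.1 hexp)
  filter_upwards [eventually_le_atBot c₀] with c hc u hu
  exact hc₀ u.re (hu.le.trans hc) u rfl

lemma exists_analyticAt_exp_eq {h : ℂ → ℂ} {w₀ : ℂ} (hh : AnalyticAt ℂ h w₀) (h0 : h w₀ ≠ 0) :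
    ∃ G : ℂ → ℂ, AnalyticAt ℂ G w₀ ∧ ∀ᶠ w in 𝓝 w₀, Complex.exp (G w) = h w := by
  refine ⟨fun w => Complex.log (h w / h w₀) + Complex.log (h w₀), ?_, ?_⟩
  · refine (AnalyticAt.clog (hh.div analyticAt_const h0) ?_).add analyticAt_const
    simp [div_self h0]
  · filter_upwards [hh.continuousAt.eventually_ne h0] with w hw
    rw [Complex.exp_add, Complex.exp_log (div_ne_zero hw h0), Complex.exp_log h0,
      div_mul_cancel₀ _ h0]

lemma eventually_atBot_lipschitzOnWith_comp_exp {G : ℂ → ℂ} (hG : AnalyticAt ℂ G 0)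
    {K : NNReal} (hK : 0 < K) :
    ∀ᶠ c : ℝ in atBot, DifferentiableOn ℂ (fun u => G (Complex.exp u)) {u | u.re < c} ∧
      LipschitzOnWith K (fun u => G (Complex.exp u)) {u | u.re < c} := by
  have hsmall : ∀ᶠ w in 𝓝 (0 : ℂ), ‖deriv G w * w‖₊ < K :=
    (hG.deriv.continuousAt.mul continuousAt_id).nnnorm.eventually_lt continuousAt_const
      (by simpa using hK)
  filter_upwards [eventually_atBot_forall_re_lt (hG.eventually_analyticAt.and hsmall)] with c hc
  have hd : ∀ u : ℂ, u.re < c → HasDerivAt (fun u => G (Complex.exp u))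
      (deriv G (Complex.exp u) * Complex.exp u) u := fun u hu =>
    (hc u hu).1.differentiableAt.hasDerivAt.comp u (Complex.hasDerivAt_exp u)
  exact ⟨fun u hu => (hd u hu).differentiableAt.differentiableWithinAt,
    (convex_halfSpace_re_lt c).lipschitzOnWith_of_nnnorm_hasDerivWithin_le
      (fun u hu => (hd u hu).hasDerivWithinAt) fun u hu => (hc u hu).2.le⟩

lemma exists_halfPlaneChart_log {h : ℂ → ℂ} (hh : AnalyticAt ℂ h 0) (h0 : h 0 ≠ 0)
    {k : ℕ} (hk : k ≠ 0) :
    ∃ φ : ℂ → ℂ, ∀ᶠ c in atBot, (∃ c', HalfPlaneChart φ {u | u.re < c} c') ∧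
      ∀ u : ℂ, u.re < c → Complex.exp (φ u) = Complex.exp u ^ k * h (Complex.exp u) := by
  obtain ⟨G, hG, hexp⟩ := exists_analyticAt_exp_eq hh h0
  have hbound : ∀ᶠ w in 𝓝 0, ‖G w‖ < ‖G 0‖ + 1 :=
    hG.continuousAt.norm.eventually_lt continuousAt_const (lt_add_one _)
  refine ⟨fun u => k * u + G (Complex.exp u), ?_⟩
  filter_upwards [eventually_atBot_lipschitzOnWith_comp_exp hG (K := 1 / 2) (by simp),
    eventually_atBot_forall_re_lt hexp, eventually_atBot_forall_re_lt hbound]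
    with c ⟨hd, hlip⟩ hcexp hcbound
  have hK : (1 / 2 : NNReal) < k := half_lt_self one_pos |>.trans_le
    (by exact_mod_cast Nat.one_le_iff_ne_zero.2 hk)
  refine ⟨⟨_, halfPlaneChart_natCast_mul_add hK hlip hd (fun u hu => (hcbound u hu).le)
    (sub_one_lt c)⟩, fun u hu => ?_⟩
  rw [Complex.exp_add, Complex.exp_nat_mul, hcexp u hu]

/-! ### The model of a logarithmic singularity -/

/-- The universal covering of a punctured disk about `a` which models a logarithmic singularity
over `a`. Small disks correspond to left half planes, also for `a = ∞`. -/
def endModel : Sphere → ℂ → ℂ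
  | ∞ => fun ζ => -Complex.exp (-ζ)
  | (b : ℂ) => fun ζ => b - Complex.exp ζ

lemma endModel_infty (ζ : ℂ) : endModel ∞ ζ = -Complex.exp (-ζ) := rfl

lemma endModel_coe (b ζ : ℂ) : endModel (b : Sphere) ζ = b - Complex.exp ζ := rfl

lemma affine_infty : affine ∞ = 0 := rfl

lemma range_endModel (a : Sphere) : range (endModel a) = {affine a}ᶜ := by
  ext w
  induction a using OnePoint.rec with
  | infty =>
    refine ⟨?_, fun hw => ⟨-Complex.log (-w), ?_⟩⟩
    · rintro ⟨ζ, rfl⟩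
      exact neg_ne_zero.2 (Complex.exp_ne_zero _)
    · rw [endModel_infty, neg_neg, Complex.exp_log (neg_ne_zero.2 hw), neg_neg]
  | coe b =>
    refine ⟨?_, fun hw => ⟨Complex.log (b - w), ?_⟩⟩
    · rintro ⟨ζ, rfl⟩
      exact mt sub_eq_self.1 (Complex.exp_ne_zero ζ)
    · have hbw : b - w ≠ 0 := sub_ne_zero.2 (Ne.symm hw)
      rw [endModel_coe, Complex.exp_log hbw, sub_sub_cancel]

lemma endModel_ne (a : Sphere) (ζ : ℂ) : (endModel a ζ : Sphere) ≠ a := by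
  rintro h
  have hne : endModel a ζ ∈ ({affine a}ᶜ : Set ℂ) := range_endModel a ▸ mem_range_self ζ
  exact hne (by rw [← h, affine_coe, h]; rfl)

lemma isCoveringMapOn_endModel (a : Sphere) :
    IsCoveringMapOn (endModel a) (range (endModel a)) := by
  rw [range_endModel]
  induction a using OnePoint.rec with
  | infty =>
    refine ((Complex.isCoveringMapOn_exp.comp_homeomorph
      (Homeomorph.neg ℂ)).homeomorph_comp (Homeomorph.neg ℂ)).mono fun w hw => ?_
    simpa [affine_infty] using hw
  | coe b =>
    refine (Complex.isCoveringMapOn_exp.homeomorph_comp (Homeomorph.subLeft b)).mono fun w hw => ?_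
    simpa [neg_add_eq_zero, affine_coe] using hw

lemma comap_endModel_nhds (a : Sphere) :
    comap (fun ζ => (endModel a ζ : Sphere)) (𝓝 a) = comap Complex.re atBot := by
  induction a using OnePoint.rec with
  | infty =>
    have hnorm : norm ∘ endModel ∞ = Real.exp ∘ Neg.neg ∘ Complex.re := by
      ext ζ
      rw [Function.comp_apply, endModel_infty, norm_neg, Complex.norm_exp]
      rfl
    have hcomap : comap (fun ζ => (endModel ∞ ζ : Sphere)) (𝓝 ∞) =
        comap (endModel ∞) (comap ((↑) : ℂ → Sphere) (𝓝 ∞)) := comap_comap.symm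
    rw [hcomap, comap_coe_nhds_infty_eq_cobounded, ← comap_norm_atTop, comap_comap, hnorm,
      ← comap_comap, Real.comap_exp_atTop, ← comap_comap]
    exact congrArg (comap Complex.re) (OrderIso.neg ℝ).comap_atBot
  | coe b =>
    have hdist : (dist · b) ∘ endModel b = Real.exp ∘ Complex.re := by
      ext ζ
      rw [Function.comp_apply, endModel_coe, dist_self_sub_left, Complex.norm_exp]
      rfl
    have hcomap : comap (fun ζ => (endModel b ζ : Sphere)) (𝓝 b) =
        comap (endModel b) (comap ((↑) : ℂ → Sphere) (𝓝 b)) := comap_comap.symm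
    rw [hcomap, OnePoint.comap_coe_nhds, ← nhds_comap_dist, comap_comap, hdist, ← comap_comap,
      Real.comap_exp_nhds_zero]

lemma norm_sq_smul_lt {E : Type*} [NormedAddCommGroup E] [InnerProductSpace ℝ E] {b t : E}
    {κ σ : ℝ} (hκ : 0 ≤ κ) (hκ1 : κ ≤ 1) (hσ : 0 < σ) (hσ1 : σ ≤ 1)
    (h : ‖t‖ ^ 2 < κ * (1 + ‖b - t‖ ^ 2)) :
    ‖σ • t‖ ^ 2 < κ * (1 + ‖b - σ • t‖ ^ 2) := by
  rw [norm_sub_sq_real] at h ⊢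
  rw [norm_smul, Real.norm_of_nonneg hσ.le, mul_pow, inner_smul_right]
  have hquad : 0 ≤ σ * (1 - σ) * ((1 - κ) * ‖t‖ ^ 2) := by
    have := sub_nonneg.2 hκ1
    have := sub_nonneg.2 hσ1
    positivity
  have hconst : 0 ≤ (1 - σ) * (κ * (1 + ‖b‖ ^ 2)) := by
    have := sub_nonneg.2 hσ1
    positivity
  linarith [mul_lt_mul_of_pos_left h hσ]

lemma sub_mem_sphericalDisk_infty {ρ : ℝ} (h0 : 0 < ρ) (hπ : ρ ≤ Real.pi) {ζ : ℂ}
    (hζ : (endModel ∞ ζ : Sphere) ∈ sphericalDisk ∞ ρ) {s : ℝ} (hs : 0 ≤ s) :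
    (endModel ∞ (ζ - s) : Sphere) ∈ sphericalDisk ∞ ρ := by
  rw [coe_mem_sphericalDisk_infty h0 hπ, endModel_infty, norm_neg, Complex.norm_exp] at hζ ⊢
  have hre : (-ζ).re ≤ (-(ζ - s)).re := by simpa using hs
  exact hζ.trans_le (by gcongr)

lemma infty_mem_sphericalDisk_coe {ρ : ℝ} (h0 : 0 < ρ) (hπ : ρ ≤ Real.pi) (b : ℂ) :
    ∞ ∈ sphericalDisk (b : Sphere) ρ ↔ 1 < Real.sin (ρ / 2) ^ 2 * (1 + ‖b‖ ^ 2) := by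
  have hs : 0 < Real.sin (ρ / 2) := Real.sin_pos_of_pos_of_lt_pi (by linarith) (by linarith)
  rw [sphericalDisk, mem_ofPred_eq, sphericalDist_coe_infty, two_mul_arcsin_lt_iff h0 hπ,
    div_lt_iff₀ (by positivity), ← sq_lt_sq₀ (by positivity) (by positivity), mul_pow,
    Real.sq_sqrt (by positivity), one_pow]

lemma sub_mem_sphericalDisk_coe {ρ : ℝ} (h0 : 0 < ρ) (hπ : ρ ≤ Real.pi) {b ζ : ℂ}
    (hb : ∞ ∉ sphericalDisk (b : Sphere) ρ)
    (hζ : (endModel b ζ : Sphere) ∈ sphericalDisk b ρ) {s : ℝ} (hs : 0 ≤ s) :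
    (endModel b (ζ - s) : Sphere) ∈ sphericalDisk b ρ := by
  rw [infty_mem_sphericalDisk_coe h0 hπ, not_lt] at hb
  have hexp : Complex.exp (ζ - s) = Real.exp (-s) • Complex.exp ζ := by
    rw [Complex.real_smul, Complex.ofReal_exp, ← Complex.exp_add, Complex.ofReal_neg,
      neg_add_eq_sub]
  rw [coe_mem_sphericalDisk_coe h0 hπ, endModel_coe, sub_sub_cancel, ← mul_assoc] at hζ ⊢
  rw [hexp]
  exact norm_sq_smul_lt (by positivity) hb (Real.exp_pos _)
    (Real.exp_le_one_iff.2 (neg_nonpos.2 hs)) hζ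

lemma sphericalDist_le_pi (a b : Sphere) : sphericalDist a b ≤ Real.pi := by
  have h (x : ℝ) : 2 * Real.arcsin x ≤ Real.pi := by linarith [Real.arcsin_le_pi_div_two x]
  induction a using OnePoint.rec <;> induction b using OnePoint.rec
  case infty.infty => exact Real.pi_nonneg
  all_goals exact h _

/-- The disk of radius `ρ₀` about `a` is so small that its preimage under the model of a
logarithmic singularity lies in the half plane `Re ζ < c`, and that the model is a covering of the
punctured disk whose preimage is a star domain with respect to `-∞`, for all smaller radii as
well. -/
structure SmallRadius (a : Sphere) (c ρ₀ : ℝ) : Prop where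
  pos : 0 < ρ₀
  re_lt : ∀ ζ, (endModel a ζ : Sphere) ∈ sphericalDisk a ρ₀ → ζ.re < c
  diff_subset_range : sphericalDisk a ρ₀ \ {a} ⊆ range fun ζ => (endModel a ζ : Sphere)
  sub_mem : ∀ ρ, 0 < ρ → ρ ≤ ρ₀ → ∀ ζ, (endModel a ζ : Sphere) ∈ sphericalDisk a ρ →
    ∀ s : ℝ, 0 ≤ s → (endModel a (ζ - s) : Sphere) ∈ sphericalDisk a ρ

lemma SmallRadius.mono {a : Sphere} {c ρ₀ ρ : ℝ} (h : SmallRadius a c ρ₀) (hpos : 0 < ρ)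
    (hρ : ρ ≤ ρ₀) : SmallRadius a c ρ where
  pos := hpos
  re_lt := fun ζ hζ => h.re_lt ζ (sphericalDisk_mono a hρ hζ)
  diff_subset_range := (sdiff_subset_sdiff_left (sphericalDisk_mono a hρ)).trans h.diff_subset_range
  sub_mem := fun ρ' hpos' hρ' => h.sub_mem ρ' hpos' (hρ'.trans hρ)

lemma exists_forall_endModel_mem_re_lt (a : Sphere) (c : ℝ) :
    ∃ ρ > 0, ∀ ζ, (endModel a ζ : Sphere) ∈ sphericalDisk a ρ → ζ.re < c := by
  have hmem : {ζ : ℂ | ζ.re < c} ∈ comap (fun ζ => (endModel a ζ : Sphere)) (𝓝 a) :=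
    comap_endModel_nhds a ▸ preimage_mem_comap (Iio_mem_atBot c)
  exact ((nhds_hasBasis_sphericalDisk a).comap _).mem_iff.1 hmem

lemma exists_forall_re_lt_endModel_mem (a : Sphere) {ρ : ℝ} (hρ : 0 < ρ) :
    ∃ c : ℝ, ∀ ζ : ℂ, ζ.re < c → (endModel a ζ : Sphere) ∈ sphericalDisk a ρ := by
  have hmem : (fun ζ => (endModel a ζ : Sphere)) ⁻¹' sphericalDisk a ρ ∈ comap Complex.re atBot :=
    comap_endModel_nhds a ▸ preimage_mem_comap (sphericalDisk_mem_nhds a hρ)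
  obtain ⟨c, -, hc⟩ := ((atBot_basis_Iio (α := ℝ)).comap Complex.re).mem_iff.1 hmem
  exact ⟨c, fun ζ hζ => hc hζ⟩

lemma exists_omitted_value (a : Sphere) :
    ∃ p ≠ a, {a, p}ᶜ ⊆ range (fun ζ => (endModel a ζ : Sphere)) ∧
      ∀ ρ, 0 < ρ → ρ ≤ Real.pi → p ∉ sphericalDisk a ρ →
        ∀ ζ, (endModel a ζ : Sphere) ∈ sphericalDisk a ρ → ∀ s : ℝ, 0 ≤ s →
          (endModel a (ζ - s) : Sphere) ∈ sphericalDisk a ρ := by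
  have hrange : ∀ w : ℂ, w ≠ affine a → (w : Sphere) ∈ range fun ζ => (endModel a ζ : Sphere) :=
    fun w hw => range_comp ((↑) : ℂ → Sphere) (endModel a) ▸
      mem_image_of_mem _ (range_endModel a ▸ hw)
  induction a using OnePoint.rec with
  | infty =>
    refine ⟨(0 : ℂ), OnePoint.coe_ne_infty 0, fun c hc => ?_, fun ρ h0 hπ _ ζ hζ s hs =>
      sub_mem_sphericalDisk_infty h0 hπ hζ hs⟩
    induction c using OnePoint.rec with
    | infty => exact absurd (Or.inl rfl) hc
    | coe w => exact hrange w fun hw => hc (Or.inr (congrArg _ hw))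
  | coe b =>
    refine ⟨∞, OnePoint.infty_ne_coe b, fun c hc => ?_, fun ρ h0 hπ hp ζ hζ s hs =>
      sub_mem_sphericalDisk_coe h0 hπ hp hζ hs⟩
    induction c using OnePoint.rec with
    | infty => exact absurd (Or.inr rfl) hc
    | coe w => exact hrange w fun hw => hc (Or.inl (congrArg _ hw))

lemma exists_smallRadius (a : Sphere) (c : ℝ) : ∃ ρ₀, SmallRadius a c ρ₀ := by
  obtain ⟨ρ₁, hρ₁, hre⟩ := exists_forall_endModel_mem_re_lt a c
  obtain ⟨p, hpa, hrange, hsub⟩ := exists_omitted_value a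
  have hp : ∀ ρ ≤ sphericalDist a p, p ∉ sphericalDisk a ρ := fun ρ hρ => not_lt.2 hρ
  refine ⟨min ρ₁ (sphericalDist a p), lt_min hρ₁ (sphericalDist_pos hpa.symm),
    fun ζ hζ => hre ζ (sphericalDisk_mono a (min_le_left _ _) hζ), fun q hq => hrange ?_,
    fun ρ hpos hρ => ?_⟩
  · rintro (rfl | rfl)
    exacts [hq.2 rfl, hp _ (min_le_right _ _) hq.1]
  · have hρp := hρ.trans (min_le_right _ _)
    exact hsub ρ hpos (hρp.trans (sphericalDist_le_pi a p)) (hp ρ hρp)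

/-! ### Logarithmic ends -/

namespace IsTranscendentalSingularity

variable {Ψ : ℂ → Sphere} {a : Sphere} {U U' : Ioi (0 : ℝ) → Set ℂ}

lemma subset_preimage (h : IsTranscendentalSingularity Ψ a U) (ρ : Ioi (0 : ℝ)) :
    U ρ ⊆ Ψ ⁻¹' sphericalDisk a ρ := by
  obtain ⟨z, -, hU⟩ := h.1 ρ
  exact hU ▸ connectedComponentIn_subset _ _

lemma isConnected (h : IsTranscendentalSingularity Ψ a U) (ρ : Ioi (0 : ℝ)) :
    IsConnected (U ρ) := by
  obtain ⟨z, hz, hU⟩ := h.1 ρ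
  exact hU ▸ isConnected_connectedComponentIn_iff.2 hz

lemma eq_connectedComponentIn (h : IsTranscendentalSingularity Ψ a U) {ρ : Ioi (0 : ℝ)} {z : ℂ}
    (hz : z ∈ U ρ) : U ρ = connectedComponentIn (Ψ ⁻¹' sphericalDisk a ρ) z := by
  obtain ⟨w, -, hU⟩ := h.1 ρ
  rw [hU] at hz ⊢
  exact connectedComponentIn_eq hz

lemma eq_of_eq (h : IsTranscendentalSingularity Ψ a U) (h' : IsTranscendentalSingularity Ψ a U')
    {ρ₀ : Ioi (0 : ℝ)} (heq : ∀ ρ ≤ ρ₀, U ρ = U' ρ) : U = U' := by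
  funext ρ
  rcases le_total ρ ρ₀ with hρ | hρ
  · exact heq ρ hρ
  · obtain ⟨z, hz⟩ := (h.isConnected ρ₀).nonempty
    have hz' : z ∈ U' ρ₀ := heq ρ₀ le_rfl ▸ hz
    rw [h.eq_connectedComponentIn (h.2.1 hρ hz), h'.eq_connectedComponentIn (h'.2.1 hρ hz')]

lemma mem_of_mem_closure (h : IsTranscendentalSingularity Ψ a U) {ρ : Ioi (0 : ℝ)} {z : ℂ}
    (hz : z ∈ closure (U ρ)) (hzρ : Ψ z ∈ sphericalDisk a ρ) : z ∈ U ρ := by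
  obtain ⟨w, hw⟩ := (h.isConnected ρ).nonempty
  have hpre : IsPreconnected (insert z (U ρ)) :=
    (h.isConnected ρ).isPreconnected.subset_closure (subset_insert _ _)
      (insert_subset hz subset_closure)
  rw [h.eq_connectedComponentIn hw]
  exact hpre.subset_connectedComponentIn (mem_insert_of_mem _ hw)
    (insert_subset hzρ (h.subset_preimage ρ)) (mem_insert _ _)

lemma exists_notMem_closure (hΨ : Continuous Ψ) (h : IsTranscendentalSingularity Ψ a U) (z : ℂ) :
    ∃ ρ, z ∉ closure (U ρ) := by
  by_contra! hz
  have hza : Ψ z = a := by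
    by_contra hne
    obtain ⟨V, V', hV, hV', hdisj⟩ := t2_separation_nhds hne
    obtain ⟨ρ, hρ, hsub⟩ := (nhds_hasBasis_sphericalDisk a).mem_iff.1 hV'
    obtain ⟨w, hw, hwU⟩ := mem_closure_iff_nhds.1 (hz ⟨ρ, hρ⟩) _ (hΨ.continuousAt hV)
    exact disjoint_left.1 hdisj hw (hsub (h.subset_preimage _ hwU))
  have hmem : z ∈ ⋂ ρ, U ρ := mem_iInter.2 fun ρ =>
    h.mem_of_mem_closure (hz ρ) (hza ▸ mem_sphericalDisk_self a ρ.2)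
  rwa [h.2.2] at hmem

lemma not_isBounded (hΨ : Continuous Ψ) (h : IsTranscendentalSingularity Ψ a U)
    (ρ₁ : Ioi (0 : ℝ)) : ¬ Bornology.IsBounded (U ρ₁) := by
  intro hb
  have hinter : (⋂ ρ : Ioi (0 : ℝ), closure (U (min ρ ρ₁))).Nonempty := by
    refine IsCompact.nonempty_iInter_of_directed_nonempty_isCompact_isClosed _
      (directed_of_isDirected_ge fun ρ ρ' hρ => closure_mono (h.2.1 (min_le_min_right _ hρ)))
      (fun ρ => (h.isConnected _).nonempty.closure)
      (fun ρ => (hb.subset (h.2.1 (min_le_right _ _))).isCompact_closure)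
      fun ρ => isClosed_closure
  obtain ⟨z, hz⟩ := hinter
  obtain ⟨ρ, hρ⟩ := h.exists_notMem_closure hΨ z
  exact hρ (closure_mono (h.2.1 (min_le_left _ _)) (mem_iInter.1 hz ρ))

end IsTranscendentalSingularity

lemma exists_monotone_connectedComponentIn {ι X : Type*} [Preorder ι] [TopologicalSpace X]
    {F V : ι → Set X} (hF : Monotone F) (hV : Monotone V) (hVF : ∀ i, V i ⊆ F i)
    (hconn : ∀ i, IsConnected (V i)) :
    ∃ U : ι → Set X, (∀ i, ∃ x ∈ V i, U i = connectedComponentIn (F i) x) ∧ Monotone U := by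
  choose p hp using fun i => (hconn i).nonempty
  refine ⟨fun i => connectedComponentIn (F i) (p i), fun i => ⟨p i, hp i, rfl⟩, fun i j hij => ?_⟩
  have hpij : p i ∈ connectedComponentIn (F j) (p j) :=
    (hconn j).isPreconnected.subset_connectedComponentIn (hp j) (hVF j) (hV hij (hp i))
  change connectedComponentIn _ _ ⊆ connectedComponentIn _ _
  rw [connectedComponentIn_eq hpij]
  exact connectedComponentIn_mono _ (hF hij)

lemma contractibleSpace_of_add_smul_mem {E : Type*} [AddCommGroup E] [Module ℝ E]
    [TopologicalSpace E] [ContinuousAdd E] [ContinuousSMul ℝ E] {P C : Set E}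
    (hC : Convex ℝ C) (hne : C.Nonempty) (hCP : C ⊆ P) {v : E}
    (hv : ∀ x ∈ P, ∀ s : ℝ, 0 ≤ s → x + s • v ∈ P) {s₀ : ℝ} (hs₀ : 0 ≤ s₀)
    (hvC : ∀ x ∈ P, x + s₀ • v ∈ C) : ContractibleSpace P := by
  obtain ⟨p, hp⟩ := hne
  rw [contractible_iff_id_nullhomotopic]
  let shift : C(P, P) := ⟨fun x => ⟨x + s₀ • v, hv x x.2 s₀ hs₀⟩, by fun_prop⟩
  have hshift : (ContinuousMap.id P).Homotopic shift :=
    ⟨{ toFun := fun x => ⟨x.2 + (x.1 * s₀ : ℝ) • v, hv x.2 x.2.2 _ (mul_nonneg x.1.2.1 hs₀)⟩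
       continuous_toFun := by fun_prop
       map_zero_left := fun x => by simp
       map_one_left := fun x => by simp [shift] }⟩
  have hconst : shift.Homotopic (ContinuousMap.const P ⟨p, hCP hp⟩) :=
    ⟨{ toFun := fun x => ⟨(1 - x.1 : ℝ) • (x.2 + s₀ • v) + (x.1 : ℝ) • p,
        hCP (hC (hvC x.2 x.2.2) hp (sub_nonneg.2 x.1.2.2) x.1.2.1 (sub_add_cancel _ _))⟩
       continuous_toFun := by fun_prop
       map_zero_left := fun x => by simp [shift]
       map_one_left := fun x => by simp }⟩
  exact ⟨_, hshift.trans hconst⟩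

/-- A bijection which is continuous and expanding up to a constant is a homeomorphism. -/
def homeomorphOfAntilipschitz {X Y : Type*} [PseudoEMetricSpace X] [PseudoEMetricSpace Y]
    {f : X → Y} {s : Set X} {t : Set Y} (hb : BijOn f s t) (hc : ContinuousOn f s)
    (ha : ∃ K, AntilipschitzWith K (s.domRestrict f)) : s ≃ₜ t where
  toEquiv := hb.equiv f
  continuous_toFun := hc.domRestrict.subtype_mk _
  continuous_invFun := by
    obtain ⟨K, hK⟩ := ha
    have hK' : AntilipschitzWith K (hb.equiv f) := hK
    exact (hK'.to_rightInverse (hb.equiv f).right_inv).continuous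

lemma IsUniversalCovering.comp_homeomorph {F Ψ : ℂ → Sphere} {U W : Set ℂ} {V : Set Sphere}
    (hF : IsUniversalCovering F W V) (e : U ≃ₜ W) (h : ∀ z : U, Ψ z = F (e z)) :
    IsUniversalCovering Ψ U V := by
  obtain ⟨hW, hmaps, hcov, hsurj⟩ := hF
  refine ⟨e.toHomotopyEquiv.simplyConnectedSpace, fun z hz => ?_, ?_, fun q hq => ?_⟩
  · exact h ⟨z, hz⟩ ▸ hmaps (e ⟨z, hz⟩).2
  · convert hcov.comp_homeomorph e using 1
    ext z
    exact h z
  · obtain ⟨w, hw, rfl⟩ := hsurj hq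
    refine ⟨e.symm ⟨w, hw⟩, Subtype.coe_prop _, ?_⟩
    rw [h, e.apply_symm_apply]

namespace SmallRadius

variable {a : Sphere} {c ρ : ℝ} (h : SmallRadius a c ρ)
include h

lemma contractibleSpace_preimage :
    ContractibleSpace {ζ | (endModel a ζ : Sphere) ∈ sphericalDisk a ρ} := by
  obtain ⟨c', hc'⟩ := exists_forall_re_lt_endModel_mem a h.pos
  refine contractibleSpace_of_add_smul_mem (convex_halfSpace_re_lt c')
    ⟨((c' - 1 : ℝ) : ℂ), by simp⟩ hc' (v := -1) (fun ζ hζ s hs => ?_) (le_max_right (c - c') 0)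
    fun ζ hζ => ?_
  · rw [smul_neg, ← sub_eq_add_neg, Complex.real_smul, mul_one]
    exact h.sub_mem ρ h.pos le_rfl ζ hζ s hs
  · have hre := h.re_lt ζ hζ
    have hmax := le_max_left (c - c') 0
    rw [mem_ofPred_eq, smul_neg, ← sub_eq_add_neg, Complex.real_smul, mul_one, Complex.sub_re,
      Complex.ofReal_re]
    linarith

lemma isUniversalCovering_endModel :
    IsUniversalCovering (fun ζ => (endModel a ζ : Sphere))
      {ζ | (endModel a ζ : Sphere) ∈ sphericalDisk a ρ} (sphericalDisk a ρ \ {a}) := by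
  have := h.contractibleSpace_preimage
  have hmaps : MapsTo (fun ζ => (endModel a ζ : Sphere))
      {ζ | (endModel a ζ : Sphere) ∈ sphericalDisk a ρ} (sphericalDisk a ρ \ {a}) :=
    fun ζ hζ => ⟨hζ, endModel_ne a ζ⟩
  refine ⟨inferInstance, hmaps, ?_, fun q hq => ?_⟩
  · set V : Set ℂ := (↑) ⁻¹' (sphericalDisk a ρ \ {a})
    have hrange : sphericalDisk a ρ \ {a} ⊆ range ((↑) : ℂ → Sphere) :=
      h.diff_subset_range.trans (range_comp_subset_range (endModel a) ((↑) : ℂ → Sphere))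
    have hV : V ⊆ range (endModel a) := fun w hw => by
      obtain ⟨ζ, hζ⟩ := h.diff_subset_range hw
      exact ⟨ζ, OnePoint.coe_injective hζ⟩
    have hW : {ζ | (endModel a ζ : Sphere) ∈ sphericalDisk a ρ} = endModel a ⁻¹' V :=
      Subset.antisymm hmaps fun ζ hζ => hζ.1
    exact (((isCoveringMapOn_endModel a).mono hV).isCoveringMap_restrictPreimage.comp_homeomorph
      (Homeomorph.setCongr hW)).homeomorph_comp
      (OnePoint.isOpenEmbedding_coe.isEmbedding.homeomorphOfSubsetRange hrange)
  · obtain ⟨ζ, rfl⟩ := h.diff_subset_range hq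
    exact ⟨ζ, hq.1, rfl⟩

end SmallRadius

/-- On the open set `H`, the function `Ψ` is the composition of the model of a logarithmic
singularity over `a` with the chart `φ`, whose values cover the half plane `Re ζ < c`. -/
structure LogEnd (Ψ : ℂ → Sphere) (a : Sphere) (φ : ℂ → ℂ) (H : Set ℂ) (c : ℝ) : Prop
    extends HalfPlaneChart φ H c where
  continuous : Continuous Ψ
  apply_eq : ∀ z ∈ H, Ψ z = endModel a (φ z)

namespace LogEnd

variable {Ψ : ℂ → Sphere} {a : Sphere} {φ : ℂ → ℂ} {H : Set ℂ} {c ρ : ℝ} (E : LogEnd Ψ a φ H c)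
include E

lemma bijOn_half_plane {c' : ℝ} (hc : c' ≤ c) :
    BijOn φ (H ∩ φ ⁻¹' {ζ | ζ.re < c'}) {ζ | ζ.re < c'} :=
  ⟨fun _ hz => hz.2, E.injOn.mono inter_subset_left, fun ζ hζ => by
    obtain ⟨z, hz, rfl⟩ := E.surjOn (lt_of_lt_of_le hζ hc)
    exact ⟨z, ⟨hz, hζ⟩, rfl⟩⟩

lemma bijOn (hρ : SmallRadius a c ρ) :
    BijOn φ (H ∩ Ψ ⁻¹' sphericalDisk a ρ) {ζ | (endModel a ζ : Sphere) ∈ sphericalDisk a ρ} := by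
  refine ⟨fun z hz => ?_, E.injOn.mono inter_subset_left, fun ζ hζ => ?_⟩
  · rw [mem_ofPred_eq, ← E.apply_eq z hz.1]
    exact hz.2
  · obtain ⟨z, hz, rfl⟩ := E.surjOn (hρ.re_lt ζ hζ)
    refine ⟨z, ⟨hz, ?_⟩, rfl⟩
    rwa [mem_preimage, E.apply_eq z hz]

/-- The chart as a homeomorphism from the tract over a small disk onto the corresponding tract of
the model. -/
def homeomorph (hρ : SmallRadius a c ρ) : (H ∩ Ψ ⁻¹' sphericalDisk a ρ : Set ℂ) ≃ₜ
    {ζ | (endModel a ζ : Sphere) ∈ sphericalDisk a ρ} :=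
  homeomorphOfAntilipschitz (E.bijOn hρ) (E.differentiableOn.continuousOn.mono inter_subset_left) <|
    E.antilipschitz.imp fun _ hK z w => hK ⟨z, z.2.1⟩ ⟨w, w.2.1⟩

lemma isUniversalCovering (hρ : SmallRadius a c ρ) :
    IsUniversalCovering Ψ (H ∩ Ψ ⁻¹' sphericalDisk a ρ) (sphericalDisk a ρ \ {a}) :=
  hρ.isUniversalCovering_endModel.comp_homeomorph (E.homeomorph hρ) fun z => E.apply_eq z z.2.1

lemma isConnected (hρ : SmallRadius a c ρ) : IsConnected (H ∩ Ψ ⁻¹' sphericalDisk a ρ) := by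
  have := hρ.contractibleSpace_preimage
  have := (E.homeomorph hρ).contractibleSpace
  exact isConnected_iff_connectedSpace.2 inferInstance

lemma isOpen_inter (ρ : ℝ) : IsOpen (H ∩ Ψ ⁻¹' sphericalDisk a ρ) :=
  E.isOpen.inter ((isOpen_sphericalDisk a ρ).preimage E.continuous)

lemma closure_inter_subset (hρ : SmallRadius a c ρ) :
    closure (H ∩ Ψ ⁻¹' sphericalDisk a ρ) ⊆ H :=
  (closure_mono (t := H ∩ φ ⁻¹' {ζ | ζ.re < c}) fun _ hz =>
    ⟨hz.1, hρ.re_lt _ ((E.bijOn hρ).mapsTo hz)⟩).trans E.closure_subset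

lemma connectedComponentIn_eq_inter (hρ : SmallRadius a c ρ) {z : ℂ}
    (hz : z ∈ H ∩ Ψ ⁻¹' sphericalDisk a ρ) :
    connectedComponentIn (Ψ ⁻¹' sphericalDisk a ρ) z = H ∩ Ψ ⁻¹' sphericalDisk a ρ := by
  refine Subset.antisymm (fun w hw => ?_)
    ((E.isConnected hρ).isPreconnected.subset_connectedComponentIn hz inter_subset_right)
  refine isPreconnected_connectedComponentIn.subset_left_of_subset_union (E.isOpen_inter ρ)
    (isClosed_closure (s := H ∩ Ψ ⁻¹' sphericalDisk a ρ)).isOpen_compl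
    (disjoint_compl_right.mono_left subset_closure) (fun v hv => ?_)
    ⟨z, mem_connectedComponentIn hz.2, hz⟩ hw
  by_cases hcl : v ∈ closure (H ∩ Ψ ⁻¹' sphericalDisk a ρ)
  · exact Or.inl ⟨E.closure_inter_subset hρ hcl, connectedComponentIn_subset _ _ hv⟩
  · exact Or.inr hcl

lemma exists_isTranscendentalSingularity :
    ∃ U, IsTranscendentalSingularity Ψ a U ∧ ∃ ρ, U ρ ⊆ H := by
  obtain ⟨ρ₀, h₀⟩ := exists_smallRadius a c
  have hsmall : ∀ ρ : Ioi (0 : ℝ), SmallRadius a c (min ρ.1 ρ₀) := fun ρ =>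
    h₀.mono (lt_min ρ.2 h₀.pos) (min_le_right _ _)
  have hsub : ∀ ρ : Ioi (0 : ℝ),
      H ∩ Ψ ⁻¹' sphericalDisk a (min ρ.1 ρ₀) ⊆ Ψ ⁻¹' sphericalDisk a ρ := fun ρ =>
    inter_subset_right.trans (preimage_mono (sphericalDisk_mono a (min_le_left _ _)))
  obtain ⟨U, hU, hmono⟩ := exists_monotone_connectedComponentIn
    (F := fun ρ : Ioi (0 : ℝ) => Ψ ⁻¹' sphericalDisk a ρ)
    (V := fun ρ => H ∩ Ψ ⁻¹' sphericalDisk a (min ρ.1 ρ₀))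
    (fun ρ ρ' hρ => preimage_mono (sphericalDisk_mono a hρ))
    (fun ρ ρ' hρ => inter_subset_inter_right H
      (preimage_mono (sphericalDisk_mono a (min_le_min_right ρ₀ hρ))))
    hsub fun ρ => E.isConnected (hsmall ρ)
  have hH : U ⟨ρ₀, h₀.pos⟩ ⊆ H := by
    obtain ⟨p, hp, hUp⟩ := hU ⟨ρ₀, h₀.pos⟩
    rw [hUp, E.connectedComponentIn_eq_inter h₀ (by simpa using hp)]
    exact inter_subset_left
  refine ⟨U, ⟨fun ρ => (hU ρ).imp fun p hp => ⟨hsub ρ hp.1, hp.2⟩, hmono, ?_⟩, _, hH⟩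
  rw [eq_empty_iff_forall_notMem]
  intro z hz
  rw [mem_iInter] at hz
  refine endModel_ne a (φ z) ?_
  rw [← E.apply_eq z (hH (hz _))]
  refine eq_of_forall_mem_sphericalDisk fun ρ hρ => ?_
  obtain ⟨p, -, hUp⟩ := hU ⟨ρ, hρ⟩
  exact connectedComponentIn_subset _ p (hUp ▸ hz ⟨ρ, hρ⟩)

section Singularity

variable {U U' : Ioi (0 : ℝ) → Set ℂ} (hU : IsTranscendentalSingularity Ψ a U)
  (hH : ∃ ρ, U ρ ⊆ H)
include hU hH

lemma exists_forall_eq_inter : ∃ ρ₀ : Ioi (0 : ℝ), SmallRadius a c ρ₀ ∧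
    ∀ ρ ≤ ρ₀, U ρ = H ∩ Ψ ⁻¹' sphericalDisk a ρ := by
  obtain ⟨ρ₁, hρ₁⟩ := hH
  obtain ⟨ρ₀, h₀⟩ := exists_smallRadius a c
  have hsmall : ∀ ρ : Ioi (0 : ℝ), ρ ≤ min ⟨ρ₀, h₀.pos⟩ ρ₁ → SmallRadius a c ρ := fun ρ hρ =>
    h₀.mono ρ.2 (hρ.trans (min_le_left _ _))
  refine ⟨_, hsmall _ le_rfl, fun ρ hρ => ?_⟩
  obtain ⟨z, hz⟩ := (hU.isConnected ρ).nonempty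
  rw [hU.eq_connectedComponentIn hz]
  exact E.connectedComponentIn_eq_inter (hsmall ρ hρ)
    ⟨hρ₁ (hU.2.1 (hρ.trans (min_le_right _ _)) hz), hU.subset_preimage ρ hz⟩

lemma eq_of_subset (hU' : IsTranscendentalSingularity Ψ a U') (hH' : ∃ ρ, U' ρ ⊆ H) : U = U' := by
  obtain ⟨ρ₀, -, heq⟩ := E.exists_forall_eq_inter hU hH
  obtain ⟨ρ₁, -, heq'⟩ := E.exists_forall_eq_inter hU' hH'
  refine hU.eq_of_eq hU' (ρ₀ := min ρ₀ ρ₁) fun ρ hρ => ?_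
  rw [heq ρ (hρ.trans (min_le_left _ _)), heq' ρ (hρ.trans (min_le_right _ _))]

lemma isLogarithmic : IsLogarithmic Ψ a U := by
  obtain ⟨ρ₀, h₀, heq⟩ := E.exists_forall_eq_inter hU hH
  exact ⟨ρ₀, heq ρ₀ le_rfl ▸ E.isUniversalCovering h₀⟩

end Singularity

lemma isOpen_half_plane (c' : ℝ) : IsOpen (H ∩ φ ⁻¹' {ζ | ζ.re < c'}) :=
  E.differentiableOn.continuousOn.isOpen_inter_preimage E.isOpen
    (isOpen_lt Complex.continuous_re continuous_const)

lemma deriv_mul_field {z m : ℂ} (hz : z ∈ H) (hm : HasDerivAt (endModel a) m (φ z)) :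
    deriv φ z * field Ψ z = m⁻¹ := by
  have hΨ : HasDerivAt (fun ζ => affine (Ψ ζ)) (m * deriv φ z) z := by
    refine (hm.comp z (E.differentiableAt hz).hasDerivAt).congr_of_eventuallyEq ?_
    filter_upwards [E.isOpen.mem_nhds hz] with w hw
    rw [E.apply_eq w hw, affine_coe, Function.comp_apply]
  rw [field, hΨ.deriv, mul_inv, mul_left_comm, mul_inv_cancel₀ (E.deriv_ne_zero hz), mul_one]

end LogEnd

lemma exists_forall_endModel_infty_mem_iff {ρ : ℝ} (h0 : 0 < ρ) (hπ : ρ < Real.pi) :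
    ∃ c : ℝ, ∀ ζ : ℂ, (endModel ∞ ζ : Sphere) ∈ sphericalDisk ∞ ρ ↔ ζ.re < c := by
  have hs : 0 < Real.sin (ρ / 2) := Real.sin_pos_of_pos_of_lt_pi (by linarith) (by linarith)
  have hs1 : Real.sin (ρ / 2) < 1 := by
    rw [← Real.sin_pi_div_two]
    exact Real.sin_lt_sin_of_lt_of_le_pi_div_two (by linarith) le_rfl (by linarith)
  set K : ℝ := 1 / Real.sin (ρ / 2) ^ 2 - 1
  have hK : 0 < K := by
    rw [sub_pos, lt_div_iff₀ (by positivity)]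
    nlinarith
  refine ⟨-(Real.log K / 2), fun ζ => ?_⟩
  rw [coe_mem_sphericalDisk_infty h0 hπ.le, endModel_infty, norm_neg, Complex.norm_exp,
    ← Real.exp_nat_mul, ← Real.log_lt_iff_lt_exp hK, Complex.neg_re]
  push_cast
  constructor <;> intro h <;> linarith

namespace LogEnd

variable {Ψ : ℂ → Sphere} {a : Sphere} {φ : ℂ → ℂ} {H W t : Set ℂ} {c : ℝ}

lemma biholomorphic_coe {b : ℂ} (E : LogEnd Ψ b φ H c) (hW : W ⊆ H) (hφ : BijOn φ W t) :
    Biholomorphic W (field Ψ) {ζ | -ζ ∈ t} Complex.exp := by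
  have hneg : BijOn (fun ζ : ℂ => -ζ) t {ζ | -ζ ∈ t} :=
    ⟨fun ζ hζ => by simpa using hζ, neg_injective.injOn, fun ζ hζ => ⟨-ζ, hζ, neg_neg ζ⟩⟩
  refine ⟨fun z => -φ z, (E.differentiableOn.mono hW).fun_neg, hneg.comp hφ, fun z hz => ?_⟩
  have hmodel : HasDerivAt (endModel b) (-Complex.exp (φ z)) (φ z) :=
    (Complex.hasDerivAt_exp (φ z)).const_sub b
  rw [deriv.fun_neg, neg_mul, E.deriv_mul_field (hW hz) hmodel, Complex.exp_neg, inv_neg, neg_neg]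

lemma biholomorphic_infty (E : LogEnd Ψ ∞ φ H c) (hW : W ⊆ H) (hφ : BijOn φ W t) :
    Biholomorphic W (field Ψ) t Complex.exp := by
  refine ⟨φ, E.differentiableOn.mono hW, hφ, fun z hz => ?_⟩
  have hmodel : HasDerivAt (endModel ∞) (Complex.exp (-φ z)) (φ z) := by
    simpa using! (hasDerivAt_neg (φ z)).cexp.fun_neg
  rw [E.deriv_mul_field (hW hz) hmodel, Complex.exp_neg, inv_inv]

variable {U : Ioi (0 : ℝ) → Set ℂ}

lemma hasHyperbolicTracts {b : ℂ} (E : LogEnd Ψ b φ H c) (hU : IsTranscendentalSingularity Ψ b U)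
    (hH : ∃ ρ, U ρ ⊆ H) : HasHyperbolicTracts b U (field Ψ) := by
  obtain ⟨ρ₀, h₀, heq⟩ := E.exists_forall_eq_inter hU hH
  refine ⟨⟨ρ₀, fun ρ hρ => ?_⟩, fun ρ => ?_⟩
  · rw [heq ρ hρ]
    exact E.biholomorphic_coe inter_subset_left (E.bijOn (h₀.mono ρ.2 hρ))
  · obtain ⟨c₁, hc₁⟩ := exists_forall_re_lt_endModel_mem b (min ρ ρ₀).2
    obtain ⟨ρ₂, hρ₂, hre⟩ := exists_forall_endModel_mem_re_lt b (min c₁ c)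
    refine ⟨min ⟨ρ₂, hρ₂⟩ ρ₀, H ∩ φ ⁻¹' {ζ | ζ.re < min c₁ c}, ?_, ?_,
      E.isOpen_half_plane _, -min c₁ c, ?_⟩
    · rw [heq _ (min_le_right _ _)]
      rintro z ⟨hz, hΨz⟩
      exact ⟨hz, hre _ (E.apply_eq z hz ▸ sphericalDisk_mono _ (min_le_left _ _) hΨz)⟩
    · refine Subset.trans ?_ (hU.2.1 (min_le_left ρ ρ₀))
      rw [heq _ (min_le_right _ _)]
      rintro z ⟨hz, hφz⟩
      refine ⟨hz, ?_⟩
      rw [mem_preimage, E.apply_eq z hz]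
      exact hc₁ _ (hφz.trans_le (min_le_left _ _))
    · convert E.biholomorphic_coe inter_subset_left (E.bijOn_half_plane (min_le_right c₁ c))
        using 1
      ext ζ
      simp only [mem_ofPred_eq, Complex.neg_re, neg_lt]

lemma hasEllipticTracts (E : LogEnd Ψ ∞ φ H c) (hU : IsTranscendentalSingularity Ψ ∞ U)
    (hH : ∃ ρ, U ρ ⊆ H) : HasEllipticTracts U (field Ψ) := by
  obtain ⟨ρ₀, h₀, heq⟩ := E.exists_forall_eq_inter hU hH
  refine ⟨min ρ₀ ⟨3, mem_Ioi.2 three_pos⟩, fun ρ hρ => ?_⟩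
  have hρ₀ : ρ ≤ ρ₀ := hρ.trans (min_le_left _ _)
  have hρ3 : ρ.1 ≤ 3 := hρ.trans (min_le_right _ _)
  obtain ⟨c', hc'⟩ := exists_forall_endModel_infty_mem_iff ρ.2 (hρ3.trans_lt Real.pi_gt_three)
  rw [heq ρ hρ₀]
  refine ⟨E.isOpen_inter ρ, c', ?_⟩
  convert E.biholomorphic_infty inter_subset_left (E.bijOn (h₀.mono ρ.2 hρ₀)) using 1
  ext ζ
  exact (hc' ζ).symm

end LogEnd

/-! ### Ends of rational functions of an exponential -/

section Barrier

lemma forall_lt_or_forall_gt_of_isPreconnected {X α : Type*} [TopologicalSpace X] [LinearOrder α]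
    [TopologicalSpace α] [OrderClosedTopology α] {C : Set X} (hC : IsPreconnected C) {f : X → α}
    (hf : ContinuousOn f C) {c : α} (hc : ∀ x ∈ C, f x ≠ c) :
    (∀ x ∈ C, f x < c) ∨ (∀ x ∈ C, c < f x) := by
  by_contra! h
  obtain ⟨⟨x, hx, hxc⟩, y, hy, hyc⟩ := h
  obtain ⟨z, hz, hzc⟩ := hC.intermediate_value hy hx hf ⟨hyc, hxc⟩
  exact hc z hz hzc

lemma exists_int_forall_mem_Ioo {X α : Type*} [TopologicalSpace X] [AddCommGroup α]
    [LinearOrder α] [IsOrderedAddMonoid α] [Archimedean α] [TopologicalSpace α]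
    [OrderClosedTopology α] {C : Set X} (hC : IsPreconnected C) {f : X → α}
    (hf : ContinuousOn f C) {θ τ : α} (hτ : 0 < τ) (hθ : ∀ n : ℤ, ∀ x ∈ C, f x ≠ θ + n • τ) :
    ∃ n : ℤ, ∀ x ∈ C, f x ∈ Ioo (θ + n • τ) (θ + (n + 1) • τ) := by
  rcases C.eq_empty_or_nonempty with rfl | ⟨x₀, hx₀⟩
  · exact ⟨0, fun x hx => hx.elim⟩
  obtain ⟨n, hn, -⟩ := existsUnique_sub_zsmul_mem_Ico hτ (f x₀) θ
  have hlower : θ + n • τ ≤ f x₀ := le_sub_iff_add_le.1 hn.1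
  have hupper : f x₀ < θ + (n + 1) • τ := by
    rw [add_zsmul, one_zsmul, add_comm (n • τ), ← add_assoc]
    exact sub_lt_iff_lt_add.1 hn.2
  have hgt := (forall_lt_or_forall_gt_of_isPreconnected hC hf (hθ n)).resolve_left fun h =>
    (h x₀ hx₀).not_ge hlower
  have hlt := (forall_lt_or_forall_gt_of_isPreconnected hC hf (hθ (n + 1))).resolve_right fun h =>
    (h x₀ hx₀).not_gt hupper
  exact ⟨n, fun x hx => ⟨hgt x hx, hlt x hx⟩⟩

/-- Two circles about the origin, joined by a radial segment with argument `θ`: the image under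
the exponential of a grid of boundaries of rectangles. A connected set whose image avoids the
barrier cannot reach two of the rectangles or ends. -/
def barrier (c θ : ℝ) : Set ℂ :=
  Metric.sphere 0 (Real.exp c) ∪ Metric.sphere 0 (Real.exp (-c)) ∪
    (fun x : ℝ => Complex.exp (x + θ * Complex.I)) '' Icc c (-c)

lemma isCompact_barrier (c θ : ℝ) : IsCompact (barrier c θ) :=
  ((isCompact_sphere _ _).union (isCompact_sphere _ _)).union
    (isCompact_Icc.image (by fun_prop))

lemma exists_eventually_disjoint_barrier {S : Set ℂ} (hS : S.Finite) :
    ∃ θ, ∀ᶠ c in atBot, Disjoint S (barrier c θ) := by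
  obtain ⟨θ, hθ, hθS⟩ := (Ioc_infinite (neg_lt_self Real.pi_pos)).exists_notMem_finite
    (hS.image Complex.arg)
  have hne : ∀ᶠ c : ℝ in atBot, ∀ w ∈ S, c ≠ Real.log ‖w‖ ∧ c ≠ -Real.log ‖w‖ :=
    hS.eventually_all.2 fun w _ => (eventually_ne_atBot _).and (eventually_ne_atBot _)
  refine ⟨θ, hne.mono fun c hc => disjoint_left.2 ?_⟩
  rintro w hw ((hwc | hwc) | ⟨x, -, rfl⟩)
  · refine (hc w hw).1 ?_
    rw [mem_sphere_zero_iff_norm.1 hwc, Real.log_exp]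
  · refine (hc w hw).2 ?_
    rw [mem_sphere_zero_iff_norm.1 hwc, Real.log_exp, neg_neg]
  · refine hθS ⟨_, hw, ?_⟩
    rw [← Complex.log_im, Complex.log_exp (by simpa using hθ.1) (by simpa using hθ.2)]
    simp

lemma isBounded_or_re_lt_of_exp_notMem_barrier {C : Set ℂ} (hC : IsPreconnected C) {c θ : ℝ}
    (hexp : ∀ u ∈ C, Complex.exp u ∉ barrier c θ) :
    Bornology.IsBounded C ∨ (∀ u ∈ C, u.re < c) ∨ (∀ u ∈ C, (-u).re < c) := by
  have hre := Complex.continuous_re.continuousOn (s := C)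
  rcases forall_lt_or_forall_gt_of_isPreconnected hC hre (c := c) (fun u hu huc => hexp u hu
    (Or.inl (Or.inl (by rw [mem_sphere_zero_iff_norm, Complex.norm_exp, huc])))) with h | hleft
  · exact Or.inr (Or.inl h)
  rcases forall_lt_or_forall_gt_of_isPreconnected hC hre (c := -c) (fun u hu huc => hexp u hu
    (Or.inl (Or.inr (by rw [mem_sphere_zero_iff_norm, Complex.norm_exp, huc])))) with hright | h
  swap
  · exact Or.inr (Or.inr fun u hu => neg_lt.1 (h u hu))
  have him : ∀ n : ℤ, ∀ u ∈ C, u.im ≠ θ + n • (2 * Real.pi) := fun n u hu hun => by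
    refine hexp u hu (Or.inr ⟨u.re, ⟨(hleft u hu).le, (hright u hu).le⟩, ?_⟩)
    refine Complex.exp_eq_exp_iff_exists_int.2 ⟨-n, Complex.ext (by simp) ?_⟩
    simp [hun]
  obtain ⟨n, hn⟩ := exists_int_forall_mem_Ioo hC Complex.continuous_im.continuousOn
    Real.two_pi_pos him
  exact Or.inl (((Metric.isBounded_Ioo c (-c)).reProdIm (Metric.isBounded_Ioo _ _)).subset
    fun u hu => ⟨⟨hleft u hu, hright u hu⟩, hn u hu⟩)

end Barrier

section RationalOfExp

open Polynomial

lemma exists_eq_X_pow_mul {R : Type*} [CommRing R] {p : R[X]} (hp : p ≠ 0) (h0 : p.eval 0 = 0) :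
    ∃ k ≠ 0, ∃ q : R[X], p = X ^ k * q ∧ q.eval 0 ≠ 0 := by
  obtain ⟨q, hq, hdvd⟩ := exists_eq_pow_rootMultiplicity_mul_and_not_dvd p hp 0
  refine ⟨p.rootMultiplicity 0, ((rootMultiplicity_pos hp).2 h0).ne', q, by simpa using hq, ?_⟩
  rwa [dvd_iff_isRoot] at hdvd

lemma exists_eval_div_eval_eq_pow_mul {P Q : ℂ[X]} (hP : P ≠ 0) (hP0 : P.eval 0 = 0)
    (hQ0 : Q.eval 0 ≠ 0) : ∃ k ≠ 0, ∃ g : ℂ → ℂ, AnalyticAt ℂ g 0 ∧ g 0 ≠ 0 ∧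
      ∀ w, P.eval w / Q.eval w = w ^ k * g w := by
  obtain ⟨k, hk, q, rfl, hq0⟩ := exists_eq_X_pow_mul hP hP0
  exact ⟨k, hk, fun w => q.eval w / Q.eval w, (q.differentiable.analyticAt 0).div
    (Q.differentiable.analyticAt 0) hQ0, div_ne_zero hq0 hQ0, fun w => by
      rw [eval_mul, eval_pow, eval_X, mul_div_assoc]⟩

variable {Ψ : ℂ → Sphere} {l : ℂ} {N D N' D' : ℂ[X]}

lemma NonconstantPair.exists_pairMap_eq_endModel (h : NonconstantPair N D) :
    ∃ k ≠ 0, ∃ g : ℂ → ℂ, AnalyticAt ℂ g 0 ∧ g 0 ≠ 0 ∧ ∀ w ζ : ℂ,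
      Complex.exp ζ = w ^ k * g w → pairMap N D w = (endModel (pairMap N D 0) ζ : Sphere) := by
  by_cases hD : D.eval 0 = 0
  · obtain ⟨k, hk, g, hg, hg0, hgw⟩ := exists_eval_div_eval_eq_pow_mul
      (neg_ne_zero.2 h.denom_ne_zero) (by rw [eval_neg, hD, neg_zero]) (h.eval_ne_zero hD)
    refine ⟨k, hk, g, hg, hg0, fun w ζ hζ => ?_⟩
    rw [← hgw, eval_neg] at hζ
    have hne := hζ ▸ Complex.exp_ne_zero ζ
    have hDw := neg_ne_zero.1 (div_ne_zero_iff.1 hne).1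
    rw [pairMap_of_eval_eq_zero hD, pairMap_of_eval_ne_zero hDw, endModel_infty,
      Complex.exp_neg, hζ, inv_div, div_neg, neg_neg]
  · obtain ⟨k, hk, g, hg, hg0, hgw⟩ := exists_eval_div_eval_eq_pow_mul
      (neg_ne_zero.2 (h.sub_ne_zero (N.eval 0 / D.eval 0))) (by simp [div_mul_cancel₀ _ hD]) hD
    refine ⟨k, hk, g, hg, hg0, fun w ζ hζ => ?_⟩
    rw [← hgw] at hζ
    have hDw := (div_ne_zero_iff.1 (hζ ▸ Complex.exp_ne_zero ζ)).2
    rw [pairMap_of_eval_ne_zero hD, pairMap_of_eval_ne_zero hDw, endModel_coe, hζ, eval_neg,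
      eval_sub, eval_mul, eval_C, neg_sub, sub_div, mul_div_cancel_right₀ _ hDw, sub_sub_cancel]

/-- `Ψ` is the nonconstant rational function `N / D` of `exp (l z)`. A function which is rational
in `exp (l z)` is also rational in `exp (-l z)`, which describes its other end. -/
structure IsRationalOfExp (Ψ : ℂ → Sphere) (l : ℂ) (N D : ℂ[X]) : Prop where
  ne_zero : l ≠ 0
  pair : NonconstantPair N D
  apply_eq : ∀ z, Ψ z = pairMap N D (Complex.exp (l * z))

namespace IsRationalOfExp

section OneEnd

variable (S : IsRationalOfExp Ψ l N D)
include S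

lemma continuous : Continuous Ψ := by
  rw [funext S.apply_eq]
  exact S.pair.continuous_pairMap.comp (by fun_prop)

lemma tendsto_atBot :
    Tendsto Ψ (comap (fun z => (l * z).re) atBot) (𝓝 (pairMap N D 0)) := by
  rw [funext S.apply_eq]
  have hexp : Tendsto (fun z => Complex.exp (l * z)) (comap (fun z => (l * z).re) atBot) (𝓝 0) := by
    rw [Complex.tendsto_exp_nhds_zero_iff]
    exact tendsto_comap
  exact (S.pair.continuous_pairMap.tendsto 0).comp hexp

lemma isAsymptoticValue : IsAsymptoticValue Ψ (pairMap N D 0) := by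
  have hl := S.ne_zero
  have hre : ∀ τ : ℝ, (l * (((-τ : ℝ) : ℂ) / l)).re = -τ := fun τ => by
    rw [mul_div_cancel₀ _ hl, Complex.ofReal_re]
  refine ⟨fun τ => ((-τ : ℝ) : ℂ) / l, by fun_prop, ?_, S.tendsto_atBot.comp ?_⟩
  · rw [← Metric.cobounded_eq_cocompact, ← tendsto_norm_atTop_iff_cobounded]
    refine (tendsto_abs_atTop_atTop.atTop_div_const (norm_pos_iff.2 hl)).congr fun τ => ?_
    rw [norm_div, Complex.norm_real, Real.norm_eq_abs, abs_neg]
  · exact tendsto_comap_iff.2 (tendsto_neg_atTop_atBot.congr fun τ => (hre τ).symm)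

lemma exists_logEnd : ∃ φ : ℂ → ℂ, ∀ᶠ c in atBot, ∃ c',
    LogEnd Ψ (pairMap N D 0) (fun z => φ (l * z)) {z | (l * z).re < c} c' := by
  obtain ⟨k, hk, g, hg, hg0, hexp⟩ := S.pair.exists_pairMap_eq_endModel
  obtain ⟨φ, hφ⟩ := exists_halfPlaneChart_log hg hg0 hk
  refine ⟨φ, hφ.mono ?_⟩
  rintro c ⟨⟨c', hchart⟩, hφexp⟩
  refine ⟨c', hchart.comp_const_mul S.ne_zero, S.continuous, fun z hz => ?_⟩
  rw [S.apply_eq, hexp _ _ (hφexp _ hz)]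

lemma eventually_isBounded_or_re_lt (a : Sphere) : ∀ᶠ c in atBot, ∀ᶠ ρ in 𝓝[>] (0 : ℝ),
    ∀ C : Set ℂ, IsPreconnected C → C ⊆ Ψ ⁻¹' sphericalDisk a ρ →
      Bornology.IsBounded C ∨ (∀ z ∈ C, (l * z).re < c) ∨ (∀ z ∈ C, (-l * z).re < c) := by
  obtain ⟨θ, hθ⟩ := exists_eventually_disjoint_barrier (S.pair.finite_setOf_pairMap_eq a)
  filter_upwards [hθ] with c hc
  have ha : (pairMap N D '' barrier c θ)ᶜ ∈ 𝓝 a := by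
    refine ((isCompact_barrier c θ).image S.pair.continuous_pairMap).isClosed.isOpen_compl.mem_nhds
      ?_
    rintro ⟨w, hw, hwa⟩
    exact disjoint_left.1 hc hwa hw
  filter_upwards [eventually_sphericalDisk_subset ha] with ρ hρ C hC hCsub
  have hbarrier : ∀ u ∈ (l * ·) '' C, Complex.exp u ∉ barrier c θ := by
    rintro _ ⟨z, hz, rfl⟩ hmem
    exact hρ (hCsub hz) ⟨_, hmem, (S.apply_eq z).symm⟩
  have hpre : IsPreconnected ((l * ·) '' C) := hC.image _ (by fun_prop)
  refine (isBounded_or_re_lt_of_exp_notMem_barrier hpre hbarrier).imp (fun h => ?_) fun h => ?_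
  · refine ((h.smul₀ l⁻¹).subset fun z hz => ?_)
    exact ⟨l * z, mem_image_of_mem _ hz, inv_mul_cancel_left₀ S.ne_zero z⟩
  · simpa only [forall_mem_image, neg_mul] using h

lemma eventually_eq_of_apply_mem (a : Sphere) : ∀ᶠ c in atBot, ∀ᶠ ρ in 𝓝[>] (0 : ℝ),
    ∀ z, (l * z).re < c → Ψ z ∈ sphericalDisk a ρ → a = pairMap N D 0 := by
  by_cases ha : a = pairMap N D 0
  · exact .of_forall fun c => .of_forall fun ρ z _ _ => ha
  obtain ⟨V, V', hV, hV', hdisj⟩ := t2_separation_nhds ha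
  obtain ⟨c₀, -, hc₀⟩ := ((atBot_basis_Iio (α := ℝ)).comap fun z => (l * z).re).mem_iff.1
    (S.tendsto_atBot hV')
  filter_upwards [eventually_le_atBot c₀] with c hc
  filter_upwards [eventually_sphericalDisk_subset hV] with ρ hρ z hz hmem
  exact (disjoint_left.1 hdisj (hρ hmem) (hc₀ (hz.trans_le hc))).elim

end OneEnd

section TwoEnds

variable (S : IsRationalOfExp Ψ l N D) (S' : IsRationalOfExp Ψ (-l) N' D')
include S S'

lemma eventually_re_lt_of_not_isBounded (a : Sphere) : ∀ᶠ c in atBot, ∀ᶠ ρ in 𝓝[>] (0 : ℝ),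
    ∀ C : Set ℂ, IsPreconnected C → C ⊆ Ψ ⁻¹' sphericalDisk a ρ → ¬ Bornology.IsBounded C →
      (a = pairMap N D 0 ∧ ∀ z ∈ C, (l * z).re < c) ∨
        (a = pairMap N' D' 0 ∧ ∀ z ∈ C, (-l * z).re < c) := by
  filter_upwards [S.eventually_isBounded_or_re_lt a, S.eventually_eq_of_apply_mem a,
    S'.eventually_eq_of_apply_mem a] with c hc hS hS'
  filter_upwards [hc, hS, hS'] with ρ hρ hS hS' C hC hCsub hunb
  obtain ⟨z, hz⟩ : C.Nonempty := nonempty_iff_ne_empty.2 fun h =>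
    hunb (h ▸ Bornology.isBounded_empty)
  rcases hρ C hC hCsub with hb | hleft | hright
  · exact absurd hb hunb
  · exact Or.inl ⟨hS z (hleft z hz) (hCsub hz), hleft⟩
  · exact Or.inr ⟨hS' z (hright z hz) (hCsub hz), hright⟩

theorem setOf_isAsymptoticValue :
    {a | IsAsymptoticValue Ψ a} = {pairMap N D 0, pairMap N' D' 0} := by
  refine Subset.antisymm ?_ (pair_subset S.isAsymptoticValue S'.isAsymptoticValue)
  rintro a ⟨α, hα, hinf, hlim⟩
  obtain ⟨c, hc⟩ := (S.eventually_re_lt_of_not_isBounded S' a).exists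
  obtain ⟨ρ, hρ, hρ0⟩ := (hc.and self_mem_nhdsWithin).exists
  obtain ⟨τ, hτ⟩ := ((hlim.eventually (sphericalDisk_mem_nhds a hρ0)).and
    (eventually_gt_atTop 0)).exists_forall_of_atTop
  have hpre : IsPreconnected (α '' Ici τ) :=
    isPreconnected_Ici.image _ (hα.mono fun x hx => (hτ x hx).2)
  have hunb : ¬ Bornology.IsBounded (α '' Ici τ) := fun hb => by
    obtain ⟨x, hx, hxτ⟩ := ((hinf.eventually hb.isCompact_closure.compl_mem_cocompact).and
      (eventually_ge_atTop τ)).exists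
    exact hx (subset_closure ⟨x, hxτ, rfl⟩)
  exact (hρ _ hpre (image_subset_iff.2 fun x hx => (hτ x hx).1) hunb).imp And.left And.left

lemma exists_subset_half_plane {a : Sphere} {U : Ioi (0 : ℝ) → Set ℂ}
    (hU : IsTranscendentalSingularity Ψ a U) (c : ℝ) :
    (a = pairMap N D 0 ∧ ∃ ρ, U ρ ⊆ {z | (l * z).re < c}) ∨
      (a = pairMap N' D' 0 ∧ ∃ ρ, U ρ ⊆ {z | (-l * z).re < c}) := by
  obtain ⟨c', hc', hle⟩ := ((S.eventually_re_lt_of_not_isBounded S' a).and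
    (eventually_le_atBot c)).exists
  obtain ⟨ρ, hρ, hρ0⟩ := (hc'.and self_mem_nhdsWithin).exists
  exact (hρ _ (hU.isConnected ⟨ρ, hρ0⟩).isPreconnected (hU.subset_preimage _)
    (hU.not_isBounded S.continuous _)).imp
    (And.imp_right fun h => ⟨_, fun z hz => (h z hz).trans_le hle⟩)
    (And.imp_right fun h => ⟨_, fun z hz => (h z hz).trans_le hle⟩)

theorem exists_setOf_isTranscendentalSingularity_eq :
    ∃ U₀ U₁ : Ioi (0 : ℝ) → Set ℂ, U₀ ≠ U₁ ∧
      {s : Sphere × (Ioi (0 : ℝ) → Set ℂ) | IsTranscendentalSingularity Ψ s.1 s.2} =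
        {(pairMap N D 0, U₀), (pairMap N' D' 0, U₁)} := by
  obtain ⟨φ₀, h₀⟩ := S.exists_logEnd
  obtain ⟨φ₁, h₁⟩ := S'.exists_logEnd
  obtain ⟨c, ⟨c₀, E₀⟩, ⟨c₁, E₁⟩, hc⟩ := (h₀.and (h₁.and (eventually_le_atBot 0))).exists
  obtain ⟨U₀, hU₀, hH₀⟩ := E₀.exists_isTranscendentalSingularity
  obtain ⟨U₁, hU₁, hH₁⟩ := E₁.exists_isTranscendentalSingularity
  refine ⟨U₀, U₁, ?_, Subset.antisymm ?_ (pair_subset hU₀ hU₁)⟩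
  · rintro rfl
    obtain ⟨ρ₀, hρ₀⟩ := hH₀
    obtain ⟨ρ₁, hρ₁⟩ := hH₁
    obtain ⟨z, hz⟩ := (hU₀.isConnected (min ρ₀ ρ₁)).nonempty
    have hleft : (l * z).re < c := hρ₀ (hU₀.2.1 (min_le_left _ _) hz)
    have hright : (-l * z).re < c := hρ₁ (hU₀.2.1 (min_le_right _ _) hz)
    rw [neg_mul, Complex.neg_re] at hright
    linarith
  · rintro ⟨a, U⟩ hU
    rcases S.exists_subset_half_plane S' hU c with ⟨rfl, hH⟩ | ⟨rfl, hH⟩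
    · exact Or.inl (Prod.ext rfl (E₀.eq_of_subset hU hH hU₀ hH₀))
    · exact Or.inr (Prod.ext rfl (E₁.eq_of_subset hU hH hU₁ hH₁))

lemma exists_logEnd_of_isTranscendentalSingularity {a : Sphere} {U : Ioi (0 : ℝ) → Set ℂ}
    (hU : IsTranscendentalSingularity Ψ a U) :
    ∃ φ H c, LogEnd Ψ a φ H c ∧ ∃ ρ, U ρ ⊆ H := by
  obtain ⟨φ₀, h₀⟩ := S.exists_logEnd
  obtain ⟨φ₁, h₁⟩ := S'.exists_logEnd
  obtain ⟨c, ⟨c₀, E₀⟩, ⟨c₁, E₁⟩⟩ := (h₀.and h₁).exists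
  rcases S.exists_subset_half_plane S' hU c with ⟨rfl, hH⟩ | ⟨rfl, hH⟩
  · exact ⟨_, _, _, E₀, hH⟩
  · exact ⟨_, _, _, E₁, hH⟩

end TwoEnds

end IsRationalOfExp

end RationalOfExp

/-! ### Periodic functions and points accumulating at infinity -/

lemma tendsto_add_natCast_mul_cobounded {𝕜 : Type*} [NormedField 𝕜] [NormSMulClass ℤ 𝕜] (z : 𝕜)
    {c : 𝕜} (hc : c ≠ 0) : Tendsto (fun n : ℕ => z + n * c) atTop (Bornology.cobounded 𝕜) := by
  refine (tendsto_const_add_cobounded z).comp ?_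
  rw [← tendsto_norm_atTop_iff_cobounded]
  simp only [norm_mul]
  exact (tendsto_norm_atTop_iff_cobounded.2 tendsto_natCast_atTop_cobounded).atTop_mul_const
    (norm_pos_iff.2 hc)

lemma accumulatesAtInfty_of_add_mem {S : Set ℂ} {c : ℂ} (hc : c ≠ 0) (hne : S.Nonempty)
    (hS : ∀ z ∈ S, z + c ∈ S) : AccumulatesAtInfty S := by
  intro K hfin
  obtain ⟨z, hz⟩ := hne
  have hmem : ∀ n : ℕ, z + n * c ∈ S := fun n => by
    induction n with
    | zero => simpa using hz
    | succ n ih => simpa [add_mul, add_assoc] using hS _ ih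
  have hlim := tendsto_add_natCast_mul_cobounded z hc
  obtain ⟨n, hn, hnK⟩ := ((hlim.eventually hfin.isBounded).and
    ((tendsto_norm_cobounded_atTop.comp hlim).eventually_gt_atTop K)).exists
  exact hn ⟨hmem n, hnK⟩

lemma AccumulatesAtInfty.mono {S S' : Set ℂ} (h : AccumulatesAtInfty S) (hS : S ⊆ S') :
    AccumulatesAtInfty S' := fun K => (h K).mono fun _ hz => ⟨hS hz.1, hz.2⟩

lemma accumulatesAtInfty_exp_eq {l w : ℂ} (hl : l ≠ 0) (hw : w ≠ 0) :
    AccumulatesAtInfty {z | Complex.exp (l * z) = w} := by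
  refine accumulatesAtInfty_of_add_mem (div_ne_zero Complex.two_pi_I_ne_zero hl)
    ⟨Complex.log w / l, ?_⟩ fun z hz => ?_
  · rw [mem_ofPred_eq, mul_div_cancel₀ _ hl, Complex.exp_log hw]
  · rwa [mem_ofPred_eq, mul_add, mul_div_cancel₀ _ hl, Complex.exp_add, Complex.exp_two_pi_mul_I,
      mul_one]

lemma eq_of_periodic_of_meromorphicAt_inv {𝕜 E : Type*} [NontriviallyNormedField 𝕜]
    [NormSMulClass ℤ 𝕜] [NormedAddCommGroup E] [NormedSpace 𝕜 E] {f : 𝕜 → E} {T : 𝕜} (hT : T ≠ 0)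
    (hf : Function.Periodic f T) (hm : MeromorphicAt (fun w => f w⁻¹) 0) (x y : 𝕜) :
    f x = f y := by
  have hseq : ∀ z, Tendsto (fun n : ℕ => (z + n * T)⁻¹) atTop (𝓝[≠] 0) := fun z =>
    tendsto_inv₀_cobounded'.comp (tendsto_add_natCast_mul_cobounded z hT)
  have hval : ∀ (z : 𝕜) (n : ℕ), f ((z + n * T)⁻¹)⁻¹ = f z := fun z n => by
    rw [inv_inv, hf.nat_mul n z]
  rcases lt_or_ge (meromorphicOrderAt (fun w => f w⁻¹) 0) 0 with hneg | hnonneg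
  · have hlim : Tendsto (fun _ : ℕ => f 0) atTop (Bornology.cobounded E) :=
      ((tendsto_cobounded_of_meromorphicOrderAt_neg hneg).comp (hseq 0)).congr (hval 0)
    rw [← tendsto_norm_atTop_iff_cobounded] at hlim
    exact absurd hlim (not_tendsto_const_atTop _ _)
  · obtain ⟨c, hc⟩ := tendsto_nhds_of_meromorphicOrderAt_nonneg hm hnonneg
    have hconst : ∀ z, f z = c := fun z =>
      tendsto_nhds_unique tendsto_const_nhds ((hc.comp (hseq z)).congr (hval z))
    rw [hconst, hconst]

lemma eq_zero_of_periodic_of_hasDerivAt {𝕜 E : Type*} [RCLike 𝕜] [NormedAddCommGroup E]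
    [NormedSpace 𝕜 E] {g : 𝕜 → E} {T : 𝕜} {c : E} (hT : T ≠ 0) (hg : Function.Periodic g T)
    (hderiv : ∀ z, HasDerivAt g c z) : c = 0 := by
  have hlin : ∀ z, HasDerivAt (fun z => g z - z • c) 0 z := fun z => by
    simpa using (hderiv z).fun_sub ((hasDerivAt_id z).smul_const c)
  have heq := is_const_of_deriv_eq_zero (fun z => (hlin z).differentiableAt)
    (fun z => (hlin z).deriv) T 0
  rw [hg.eq] at heq
  simpa [hT] using heq

/-! ### The vector field -/

lemma periodic_field {Ψ : ℂ → Sphere} {T : ℂ} (h : Function.Periodic Ψ T) :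
    Function.Periodic (field Ψ) T := fun z => by
  simp only [field, ← deriv_comp_add_const (fun ζ => affine (Ψ ζ)) T z, h _]

lemma field_eq_inv (Ψ : ℂ → Sphere) : field Ψ = (deriv fun z => affine (Ψ z))⁻¹ := rfl

lemma hasResidue_deriv_zero {g : ℂ → ℂ} {z : ℂ} (hg : MeromorphicAt g z) :
    HasResidue (deriv g) z 0 := by
  obtain ⟨δ, hδ, hball⟩ := Metric.eventually_nhds_iff_ball.1
    (eventually_nhdsWithin_iff.1 hg.eventually_analyticAt)
  filter_upwards [Ioo_mem_nhdsGT hδ] with ε ⟨hε, hεδ⟩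
  rw [circleIntegral.integral_eq_zero_of_hasDerivWithinAt' (f := g), mul_zero]
  intro v hv
  rw [abs_of_pos hε] at hv
  exact (hball v (Metric.sphere_subset_ball hεδ hv)
    (Metric.ne_of_mem_sphere hv hε.ne')).differentiableAt.hasDerivAt.hasDerivWithinAt

section RationalFunction

open Polynomial

variable {N D : ℂ[X]}

lemma affine_comp_pairMap (N D : ℂ[X]) :
    (fun w => affine (pairMap N D w)) = fun w => N.eval w / D.eval w := funext affine_pairMap

lemma meromorphicAt_affine_pairMap (N D : ℂ[X]) (w : ℂ) :
    MeromorphicAt (fun w => affine (pairMap N D w)) w :=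
  affine_comp_pairMap N D ▸
    (N.differentiable.analyticAt w).meromorphicAt.fun_div
      (D.differentiable.analyticAt w).meromorphicAt

lemma analyticAt_affine_pairMap {w : ℂ} (hw : pairMap N D w ≠ ∞) :
    AnalyticAt ℂ (fun w => affine (pairMap N D w)) w :=
  affine_comp_pairMap N D ▸ (N.differentiable.analyticAt w).fun_div (D.differentiable.analyticAt w)
    (mt pairMap_eq_infty_iff.2 hw)

variable (h : NonconstantPair N D)
include h

lemma NonconstantPair.eventually_pairMap_ne_infty (w : ℂ) :
    ∀ᶠ v in 𝓝[≠] w, pairMap N D v ≠ ∞ :=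
  (eventually_nhdsNE_eval_ne_zero h.denom_ne_zero w).mono fun _ => mt pairMap_eq_infty_iff.1

lemma NonconstantPair.eventually_deriv_affine_pairMap_ne_zero (w : ℂ) :
    ∀ᶠ v in 𝓝[≠] w, deriv (fun w => affine (pairMap N D w)) v ≠ 0 := by
  filter_upwards [eventually_nhdsNE_eval_ne_zero h.denom_ne_zero w,
    eventually_nhdsNE_eval_ne_zero h.derivative_mul_sub_ne_zero w] with v hD hW
  rw [affine_comp_pairMap, ((N.hasDerivAt v).fun_div (D.hasDerivAt v) hD).deriv]
  exact div_ne_zero (by simpa using hW) (pow_ne_zero 2 hD)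

lemma NonconstantPair.meromorphicOrderAt_affine_pairMap_neg_iff {w : ℂ} :
    meromorphicOrderAt (fun w => affine (pairMap N D w)) w < 0 ↔ pairMap N D w = ∞ := by
  refine ⟨fun hneg => by_contra fun hw => ?_, fun hw => ?_⟩
  · exact (analyticAt_affine_pairMap hw).meromorphicOrderAt_nonneg.not_gt hneg
  · rw [← tendsto_cobounded_iff_meromorphicOrderAt_neg (meromorphicAt_affine_pairMap N D w),
      affine_comp_pairMap]
    exact h.tendsto_eval_div_cobounded (pairMap_eq_infty_iff.1 hw)

end RationalFunction

namespace IsRationalOfExp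

open Polynomial

variable {Ψ : ℂ → Sphere} {l : ℂ} {N D : ℂ[X]} (S : IsRationalOfExp Ψ l N D)
include S

lemma periodic : Function.Periodic Ψ (2 * Real.pi * Complex.I / l) := fun z => by
  rw [S.apply_eq, S.apply_eq, mul_add, mul_div_cancel₀ _ S.ne_zero, Complex.exp_add,
    Complex.exp_two_pi_mul_I, mul_one]

lemma affine_comp_eq :
    (fun z => affine (Ψ z)) = (fun w => affine (pairMap N D w)) ∘ fun z => Complex.exp (l * z) :=
  funext fun z => congrArg affine (S.apply_eq z)

lemma deriv_exp_ne_zero (z : ℂ) : deriv (fun z => Complex.exp (l * z)) z ≠ 0 := by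
  rw [((hasDerivAt_id' z).const_mul l).cexp.deriv, mul_one]
  exact mul_ne_zero (Complex.exp_ne_zero _) S.ne_zero

lemma deriv_affine {z : ℂ} (hz : Ψ z ≠ ∞) : deriv (fun z => affine (Ψ z)) z =
    deriv (fun w => affine (pairMap N D w)) (Complex.exp (l * z)) *
      deriv (fun z => Complex.exp (l * z)) z := by
  rw [S.affine_comp_eq]
  exact deriv_comp z (analyticAt_affine_pairMap (S.apply_eq z ▸ hz)).differentiableAt (by fun_prop)

lemma meromorphicAt_affine (z : ℂ) : MeromorphicAt (fun z => affine (Ψ z)) z := by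
  rw [S.affine_comp_eq]
  exact (meromorphicAt_affine_pairMap N D _).comp_analyticAt (by fun_prop)

lemma meromorphicAt_field (z : ℂ) : MeromorphicAt (field Ψ) z :=
  (S.meromorphicAt_affine z).deriv.inv

lemma eventually_deriv_affine_ne_zero (z : ℂ) :
    ∀ᶠ ζ in 𝓝[≠] z, deriv (fun z => affine (Ψ z)) ζ ≠ 0 := by
  have hexp : Tendsto (fun z => Complex.exp (l * z)) (𝓝[≠] z) (𝓝[≠] Complex.exp (l * z)) :=
    HasDerivAt.tendsto_nhdsNE (DifferentiableAt.hasDerivAt (by fun_prop)) (S.deriv_exp_ne_zero z)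
  filter_upwards [hexp.eventually (S.pair.eventually_pairMap_ne_infty _),
    hexp.eventually (S.pair.eventually_deriv_affine_pairMap_ne_zero _)] with ζ hfin hderiv
  rw [S.deriv_affine (S.apply_eq ζ ▸ hfin)]
  exact mul_ne_zero hderiv (S.deriv_exp_ne_zero ζ)

theorem setOf_isEssentialSingularity_field :
    {p : Sphere | IsEssentialSingularity (field Ψ) p} = {∞} := by
  refine Subset.antisymm (fun p hp => ?_) (singleton_subset_iff.2 fun hm => ?_)
  · induction p using OnePoint.rec with
    | infty => rfl
    | coe z => exact absurd (S.meromorphicAt_field z) hp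
  have hinv : MeromorphicAt (fun w => field Ψ w⁻¹) 0 := by
    have hsq : MeromorphicAt (fun w : ℂ => (-w ^ 2)⁻¹) 0 := by fun_prop
    refine (hsq.fun_mul hm).congr ?_
    filter_upwards [self_mem_nhdsWithin] with w hw
    exact inv_mul_cancel_left₀ (neg_ne_zero.2 (pow_ne_zero 2 hw)) _
  have hT := div_ne_zero Complex.two_pi_I_ne_zero S.ne_zero
  have hderiv : ∀ z, deriv (fun z => affine (Ψ z)) z = deriv (fun z => affine (Ψ z)) 0 := fun z =>
    inv_injective (eq_of_periodic_of_meromorphicAt_inv hT (periodic_field S.periodic) hinv z 0)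
  obtain ⟨z, hz⟩ := (S.eventually_deriv_affine_ne_zero 0).exists
  rw [hderiv] at hz
  exact hz (eq_zero_of_periodic_of_hasDerivAt hT (S.periodic.comp affine) fun z =>
    hderiv z ▸ (differentiableAt_of_deriv_ne_zero (hderiv z ▸ hz)).hasDerivAt)

theorem accumulatesAtInfty_poles {w : ℂ} (hw : w ≠ 0) (hcrit : IsCriticalPoint (pairMap N D) w)
    (hfin : pairMap N D w ≠ ∞) : AccumulatesAtInfty (poles (field Ψ)) := by
  have hderiv := hcrit.elim And.right fun hpole => absurd hpole.1 hfin
  refine (accumulatesAtInfty_exp_eq S.ne_zero hw).mono fun z hz => ?_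
  obtain rfl : Complex.exp (l * z) = w := hz
  have hzero : deriv (fun z => affine (Ψ z)) z = 0 := by
    rw [S.deriv_affine (S.apply_eq z ▸ hfin), hderiv, zero_mul]
  have hana : AnalyticAt ℂ (fun z => affine (Ψ z)) z := by
    rw [S.affine_comp_eq]
    exact (analyticAt_affine_pairMap hfin).comp (f := fun z => Complex.exp (l * z)) (by fun_prop)
  rw [poles, mem_ofPred_eq,
    ← tendsto_cobounded_iff_meromorphicOrderAt_neg (S.meromorphicAt_field z)]
  exact tendsto_inv₀_nhdsNE_zero.comp (tendsto_nhdsWithin_iff.2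
    ⟨hzero ▸ hana.deriv.continuousAt.continuousWithinAt, S.eventually_deriv_affine_ne_zero z⟩)

theorem accumulatesAtInfty_residueFreeZeros {w : ℂ} (hw : w ≠ 0) {m : ℕ} (hm : 1 ≤ m)
    (hord : meromorphicOrderAt (fun w => affine (pairMap N D w)) w =
      ((-(m : ℤ) : ℤ) : WithTop ℤ)) :
    AccumulatesAtInfty (residueFreeZeros (field Ψ) (m + 1)) := by
  refine (accumulatesAtInfty_exp_eq S.ne_zero hw).mono fun z hz => ⟨?_, ?_⟩
  · obtain rfl : Complex.exp (l * z) = w := hz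
    rw [← meromorphicOrderAt_comp_of_deriv_ne_zero (by fun_prop) (S.deriv_exp_ne_zero z),
      ← S.affine_comp_eq] at hord
    have hm0 : ((-(m : ℤ) : ℤ) : ℂ) ≠ 0 := by rw [Int.cast_ne_zero]; omega
    rw [field_eq_inv, meromorphicOrderAt_inv, meromorphicOrderAt_deriv_eq_sub_one hm0 hord,
      ← WithTop.LinearOrderedAddCommGroup.coe_neg]
    congr 1
    push_cast
    ring
  · simpa only [field, inv_inv] using hasResidue_deriv_zero (S.meromorphicAt_affine z)

end IsRationalOfExp

/-! ### The space of rational functions of a given degree -/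

section Family

open Polynomial

section Field

variable {K : Type*} [Field K]

lemma exists_eq_num_mul_and_eq_denom_mul (N : K[X]) {D : K[X]} (hD : D ≠ 0) :
    ∃ g : K[X], g ≠ 0 ∧
      N = (algebraMap K[X] (RatFunc K) N / algebraMap K[X] (RatFunc K) D).num * g ∧
      D = (algebraMap K[X] (RatFunc K) N / algebraMap K[X] (RatFunc K) D).denom * g := by
  set R := algebraMap K[X] (RatFunc K) N / algebraMap K[X] (RatFunc K) D with hR
  obtain ⟨g, hg⟩ : R.denom ∣ D := RatFunc.denom_div_dvd N D
  refine ⟨g, right_ne_zero_of_mul (hg ▸ hD), ?_, hg⟩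
  have hcross : R.num * D = N * R.denom := (RatFunc.num_mul_eq_mul_denom_iff hD).2 hR
  refine mul_right_cancel₀ R.denom_ne_zero ?_
  rw [← hcross, mul_assoc, mul_comm g, ← hg]

lemma max_natDegree_mul_right (N : K[X]) {D g : K[X]} (hD : D ≠ 0) (hg : g ≠ 0) :
    max (N * g).natDegree (D * g).natDegree = max N.natDegree D.natDegree + g.natDegree := by
  rw [natDegree_mul hD hg]
  rcases eq_or_ne N 0 with rfl | hN
  · simp
  · rw [natDegree_mul hN hg, max_add_add_right]

lemma max_natDegree_add_C_mul (N D : K[X]) (s : K) :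
    max N.natDegree (D + C s * N).natDegree = max N.natDegree D.natDegree := by
  have hs : (C s * N).natDegree ≤ N.natDegree := natDegree_C_mul_le s N
  rcases lt_or_ge N.natDegree D.natDegree with h | h
  · rw [natDegree_add_eq_left_of_natDegree_lt (hs.trans_lt h)]
  · rw [max_eq_left h, max_eq_left ((natDegree_add_le _ _).trans (max_le h hs))]

lemma NonconstantPair.coeff_mul_sub_coeff_mul_ne_zero {N D : K[X]} (h : NonconstantPair N D) {r : ℕ}
    (hr : max N.natDegree D.natDegree = r) : C (D.coeff r) * N - C (N.coeff r) * D ≠ 0 := by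
  intro h0
  obtain ⟨hD, hN⟩ := LinearIndependent.pair_iff.1 h.linearIndependent (D.coeff r) (-N.coeff r)
    (by rw [smul_eq_C_mul, neg_smul, smul_eq_C_mul, ← sub_eq_add_neg, h0])
  rcases max_choice N.natDegree D.natDegree with hm | hm
  · rw [← hr, hm, neg_eq_zero, coeff_natDegree, leadingCoeff_eq_zero] at hN
    exact h.linearIndependent.ne_zero 0 hN
  · rw [← hr, hm, coeff_natDegree, leadingCoeff_eq_zero] at hD
    exact h.denom_ne_zero hD

end Field

lemma ratDegree_div {N D : ℂ[X]} (h : IsCoprime N D) (hD : D ≠ 0) :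
    ratDegree (algebraMap ℂ[X] (RatFunc ℂ) N / algebraMap ℂ[X] (RatFunc ℂ) D) =
      max N.natDegree D.natDegree := by
  obtain ⟨g, hg, hNg, hDg⟩ := exists_eq_num_mul_and_eq_denom_mul N hD
  have hgu : IsUnit g := h.isUnit_of_dvd' (hNg ▸ dvd_mul_left _ _) (hDg ▸ dvd_mul_left _ _)
  set R := algebraMap ℂ[X] (RatFunc ℂ) N / algebraMap ℂ[X] (RatFunc ℂ) D
  rw [hNg, hDg, max_natDegree_mul_right _ R.denom_ne_zero hg, natDegree_eq_zero_of_isUnit hgu,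
    add_zero, ratDegree]

variable {r : ℕ}

lemma coeff_coeffPoly (c : Fin (r + 1) → ℂ) (i : Fin (r + 1)) : (coeffPoly c).coeff i = c i := by
  simp [coeffPoly, coeff_monomial, Fin.val_inj]

lemma natDegree_coeffPoly_le (c : Fin (r + 1) → ℂ) : (coeffPoly c).natDegree ≤ r :=
  natDegree_sum_le_of_forall_le _ _ fun i _ => (natDegree_monomial_le _).trans (by omega)

lemma coeffPoly_coeff {p : ℂ[X]} (hp : p.natDegree ≤ r) :
    coeffPoly (fun i : Fin (r + 1) => p.coeff i) = p := by
  ext n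
  rcases le_or_gt n r with hn | hn
  · exact coeff_coeffPoly (fun i : Fin (r + 1) => p.coeff i) ⟨n, by omega⟩
  · rw [coeff_eq_zero_of_natDegree_lt ((natDegree_coeffPoly_le _).trans_lt hn),
      coeff_eq_zero_of_natDegree_lt (hp.trans_lt hn)]

namespace RatCoeffs

lemma exists_eq_mul_C (c : RatCoeffs r) : ∃ k : ℂ, k ≠ 0 ∧
    coeffPoly c.1.1 = (coeffQuot c.1).num * C k ∧
    coeffPoly c.1.2 = (coeffQuot c.1).denom * C k := by
  obtain ⟨g, hg, hN, hD⟩ := exists_eq_num_mul_and_eq_denom_mul (coeffPoly c.1.1) c.2.1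
  have hmax := max_natDegree_mul_right (coeffQuot c.1).num (coeffQuot c.1).denom_ne_zero hg
  have hdeg : max (coeffQuot c.1).num.natDegree (coeffQuot c.1).denom.natDegree = r := c.2.2
  have hle := max_le (natDegree_coeffPoly_le c.1.1) (natDegree_coeffPoly_le c.1.2)
  change coeffPoly c.1.1 = (coeffQuot c.1).num * g at hN
  change coeffPoly c.1.2 = (coeffQuot c.1).denom * g at hD
  rw [hN, hD, hmax, hdeg] at hle
  have hgC : g = C (g.coeff 0) := eq_C_of_natDegree_eq_zero (by omega)
  exact ⟨g.coeff 0, fun h0 => hg (by rw [hgC, h0, C_0]), hgC ▸ hN, hgC ▸ hD⟩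

lemma isCoprime (c : RatCoeffs r) : IsCoprime (coeffPoly c.1.1) (coeffPoly c.1.2) := by
  obtain ⟨k, hk, hN, hD⟩ := c.exists_eq_mul_C
  have hu : IsUnit (C k) := isUnit_C.2 hk.isUnit
  rw [hN, hD, isCoprime_mul_unit_right hu]
  exact RatFunc.isCoprime_num_denom _

lemma max_natDegree (c : RatCoeffs r) :
    max (coeffPoly c.1.1).natDegree (coeffPoly c.1.2).natDegree = r := by
  obtain ⟨k, hk, hN, hD⟩ := c.exists_eq_mul_C
  rw [hN, hD, natDegree_mul_C hk, natDegree_mul_C hk]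
  exact c.2.2

lemma nonconstantPair (hr : 1 ≤ r) (c : RatCoeffs r) :
    NonconstantPair (coeffPoly c.1.1) (coeffPoly c.1.2) :=
  .of_isCoprime c.isCoprime (c.max_natDegree.symm ▸ hr)

lemma ratMap_coeffQuot_zero (c : RatCoeffs r) :
    ratMap (coeffQuot c.1) ((0 : ℂ) : Sphere) = projPoint (c.1.1 0) (c.1.2 0) := by
  obtain ⟨k, hk, hN, hD⟩ := c.exists_eq_mul_C
  rw [← coeff_coeffPoly c.1.1, ← coeff_coeffPoly c.1.2, hN, hD, coeff_mul_C, coeff_mul_C,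
    projPoint_mul_right _ _ hk, ratMap_zero, Fin.val_zero]

lemma ratMap_coeffQuot_infty (c : RatCoeffs r) :
    ratMap (coeffQuot c.1) ∞ = projPoint (c.1.1 (Fin.last r)) (c.1.2 (Fin.last r)) := by
  obtain ⟨k, hk, hN, hD⟩ := c.exists_eq_mul_C
  rw [← coeff_coeffPoly c.1.1, ← coeff_coeffPoly c.1.2, hN, hD, coeff_mul_C, coeff_mul_C,
    projPoint_mul_right _ _ hk, ratMap_infty, c.2.2, Fin.val_last]

instance : TopologicalSpace (RatCoeffs r) := instTopologicalSpaceSubtype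

@[fun_prop]
lemma continuous_num (i : Fin (r + 1)) : Continuous fun c : RatCoeffs r => c.1.1 i :=
  (continuous_apply i).comp (continuous_fst.comp continuous_subtype_val)

@[fun_prop]
lemma continuous_denom (i : Fin (r + 1)) : Continuous fun c : RatCoeffs r => c.1.2 i :=
  (continuous_apply i).comp (continuous_snd.comp continuous_subtype_val)

/-- The rational function with given homogeneous coordinates. -/
def toRatMaps (c : RatCoeffs r) : RatMaps r := ⟨coeffQuot c.1, c.2.2⟩

lemma surjective_toRatMaps : Function.Surjective (toRatMaps : RatCoeffs r → RatMaps r) := by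
  rintro ⟨R, hR⟩
  have hN : R.num.natDegree ≤ r := hR ▸ le_max_left _ _
  have hD : R.denom.natDegree ≤ r := hR ▸ le_max_right _ _
  have hquot : coeffQuot (r := r) (fun i => R.num.coeff i, fun i => R.denom.coeff i) = R := by
    rw [coeffQuot, coeffPoly_coeff hN, coeffPoly_coeff hD, RatFunc.num_div_denom]
  exact ⟨⟨_, by rw [coeffPoly_coeff hD]; exact R.denom_ne_zero, by rw [hquot, hR]⟩,
    Subtype.ext hquot⟩

lemma isQuotientMap_toRatMaps : IsQuotientMap (toRatMaps : RatCoeffs r → RatMaps r) :=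
  ⟨⟨rfl⟩, surjective_toRatMaps⟩

lemma toRatMaps_mem_subfamily_zero_iff (c : RatCoeffs r) :
    c.toRatMaps ∈ subfamily r 0 ↔ c.1.2 0 ≠ 0 ∧ c.1.2 (Fin.last r) ≠ 0 ∧
      c.1.2 (Fin.last r) * c.1.1 0 ≠ c.1.1 (Fin.last r) * c.1.2 0 := by
  change ratMap (coeffQuot c.1) _ ≠ ratMap (coeffQuot c.1) _ ∧ ratMap (coeffQuot c.1) _ ≠ _ ∧
    ratMap (coeffQuot c.1) _ ≠ _ ↔ _
  rw [ratMap_coeffQuot_zero, ratMap_coeffQuot_infty, projPoint_eq_infty_iff.ne,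
    projPoint_eq_infty_iff.ne]
  constructor
  · rintro ⟨hne, h0, h1⟩
    refine ⟨h0, h1, fun h => hne ?_⟩
    rw [projPoint_eq_projPoint_iff h0 h1, mul_comm, h]
  · rintro ⟨h0, h1, hne⟩
    refine ⟨fun h => hne ?_, h0, h1⟩
    rw [mul_comm, (projPoint_eq_projPoint_iff h0 h1).1 h]

/-- Homogeneous coordinates of the quotient of two coprime polynomials. -/
def ofIsCoprime (hr : 1 ≤ r) (N D : ℂ[X]) (hcop : IsCoprime N D)
    (hdeg : max N.natDegree D.natDegree = r) : RatCoeffs r :=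
  ⟨(fun i => N.coeff i, fun i => D.coeff i), by
    have hD : D ≠ 0 := (NonconstantPair.of_isCoprime hcop (hdeg.symm ▸ hr)).denom_ne_zero
    rw [coeffQuot, coeffPoly_coeff ((le_max_left _ _).trans_eq hdeg),
      coeffPoly_coeff ((le_max_right _ _).trans_eq hdeg), ratDegree_div hcop hD]
    exact ⟨hD, hdeg⟩⟩

/-- The homogeneous coordinates of `R(w + t)`, where `R` has homogeneous coordinates `c`. For most
`t` its values at `0` and `∞` are different. -/
def translate (hr : 1 ≤ r) (c : RatCoeffs r) (t : ℂ) : RatCoeffs r :=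
  ofIsCoprime hr (taylor t (coeffPoly c.1.1)) (taylor t (coeffPoly c.1.2))
    (c.isCoprime.map (taylorAlgHom t).toRingHom)
    (by rw [natDegree_taylor, natDegree_taylor, c.max_natDegree])

/-- The homogeneous coordinates of `R / (1 + s R)`, where `R` has homogeneous coordinates `c`. For
most `s` its values at `0` and `∞` are finite. -/
def shear (hr : 1 ≤ r) (c : RatCoeffs r) (s : ℂ) : RatCoeffs r :=
  ofIsCoprime hr (coeffPoly c.1.1) (coeffPoly c.1.2 + C s * coeffPoly c.1.1)
    (c.isCoprime.add_mul_right_right _) (by rw [max_natDegree_add_C_mul, c.max_natDegree])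

lemma translate_zero (hr : 1 ≤ r) (c : RatCoeffs r) : translate hr c 0 = c := by
  refine Subtype.ext (Prod.ext (funext fun i => ?_) (funext fun i => ?_))
  · exact (congrArg (coeff · (i : ℕ)) (taylor_zero _)).trans (coeff_coeffPoly _ i)
  · exact (congrArg (coeff · (i : ℕ)) (taylor_zero _)).trans (coeff_coeffPoly _ i)

lemma shear_zero (hr : 1 ≤ r) (c : RatCoeffs r) : shear hr c 0 = c := by
  refine Subtype.ext (Prod.ext (funext fun i => coeff_coeffPoly _ i) (funext fun i => ?_))
  change (coeffPoly c.1.2 + C 0 * coeffPoly c.1.1).coeff i = _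
  rw [C_0, zero_mul, add_zero, coeff_coeffPoly]

lemma continuous_translate (hr : 1 ≤ r) (c : RatCoeffs r) : Continuous (translate hr c) := by
  refine Continuous.subtype_mk (.prodMk (continuous_pi fun i => ?_) (continuous_pi fun i => ?_)) _
  all_goals
    simp only [taylor_coeff]
    exact Polynomial.continuous _

lemma continuous_shear (hr : 1 ≤ r) (c : RatCoeffs r) : Continuous (shear hr c) := by
  refine Continuous.subtype_mk (.prodMk continuous_const (continuous_pi fun i => ?_)) _
  simp only [coeff_add, coeff_C_mul]
  fun_prop

end RatCoeffs

lemma coeff_taylor_of_natDegree_le {R : Type*} [CommSemiring R] {p : R[X]} {n : ℕ}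
    (hp : p.natDegree ≤ n) (t : R) : (taylor t p).coeff n = p.coeff n := by
  rcases hp.eq_or_lt with h | h
  · rw [← h, coeff_taylor_natDegree, leadingCoeff]
  · rw [coeff_eq_zero_of_natDegree_lt h, coeff_eq_zero_of_natDegree_lt (by rwa [natDegree_taylor])]

lemma eventually_nhdsNE_add_mul_ne_zero {x y : ℂ} (h : x ≠ 0 ∨ y ≠ 0) :
    ∀ᶠ s in 𝓝[≠] (0 : ℂ), x + s * y ≠ 0 := by
  have hp : C x + C y * X ≠ 0 := fun h0 => h.elim
    (fun hx => hx (by simpa using congrArg (eval 0) h0))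
    (fun hy => hy (by simpa [coeff_C] using congrArg (coeff · 1) h0))
  simpa [mul_comm y] using eventually_nhdsNE_eval_ne_zero hp 0

lemma mem_closure_of_curve {X : Type*} [TopologicalSpace X] {γ : ℂ → X} (hγ : Continuous γ)
    {A : Set X} (hA : ∀ᶠ t in 𝓝[≠] (0 : ℂ), γ t ∈ A) : γ 0 ∈ closure A :=
  mem_closure_of_tendsto ((hγ.tendsto 0).mono_left nhdsWithin_le_nhds) hA

namespace RatCoeffs

lemma mem_closure_setOf_values_ne (hr : 1 ≤ r) (c : RatCoeffs r) :
    c ∈ closure {c : RatCoeffs r |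
      c.1.2 (Fin.last r) * c.1.1 0 ≠ c.1.1 (Fin.last r) * c.1.2 0} := by
  rw [← translate_zero hr c]
  refine mem_closure_of_curve (continuous_translate hr c) ?_
  have hp := (c.nonconstantPair hr).coeff_mul_sub_coeff_mul_ne_zero c.max_natDegree
  filter_upwards [eventually_nhdsNE_eval_ne_zero hp 0] with t ht
  change (taylor t _).coeff r * (taylor t _).coeff 0 ≠ (taylor t _).coeff r * (taylor t _).coeff 0
  rw [coeff_taylor_of_natDegree_le (natDegree_coeffPoly_le _),
    coeff_taylor_of_natDegree_le (natDegree_coeffPoly_le _), taylor_coeff_zero, taylor_coeff_zero]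
  simpa [sub_ne_zero] using ht

lemma mem_closure_preimage_subfamily_zero (hr : 1 ≤ r) {c : RatCoeffs r}
    (hc : c.1.2 (Fin.last r) * c.1.1 0 ≠ c.1.1 (Fin.last r) * c.1.2 0) :
    c ∈ closure (toRatMaps ⁻¹' subfamily r 0) := by
  have hshear (s : ℂ) (i : Fin (r + 1)) : (shear hr c s).1.2 i = c.1.2 i + s * c.1.1 i := by
    change (coeffPoly c.1.2 + C s * coeffPoly c.1.1).coeff i = _
    rw [coeff_add, coeff_C_mul, coeff_coeffPoly, coeff_coeffPoly]
  have hnum (s : ℂ) (i : Fin (r + 1)) : (shear hr c s).1.1 i = c.1.1 i := coeff_coeffPoly _ i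
  have h0 : c.1.2 0 ≠ 0 ∨ c.1.1 0 ≠ 0 := by
    by_contra! h
    exact hc (by rw [h.1, h.2, mul_zero, mul_zero])
  have h1 : c.1.2 (Fin.last r) ≠ 0 ∨ c.1.1 (Fin.last r) ≠ 0 := by
    by_contra! h
    exact hc (by rw [h.1, h.2, zero_mul, zero_mul])
  rw [← shear_zero hr c]
  refine mem_closure_of_curve (continuous_shear hr c) ?_
  filter_upwards [eventually_nhdsNE_add_mul_ne_zero h0,
    eventually_nhdsNE_add_mul_ne_zero h1] with s hs0 hs1
  rw [mem_preimage, toRatMaps_mem_subfamily_zero_iff, hshear, hshear, hnum, hnum]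
  exact ⟨hs0, hs1, fun h => hc (by linear_combination h)⟩

end RatCoeffs

lemma isOpen_subfamily_zero (r : ℕ) : IsOpen (subfamily r 0) := by
  have hpre : RatCoeffs.toRatMaps ⁻¹' subfamily r 0 = {c : RatCoeffs r | c.1.2 0 ≠ 0} ∩
      ({c | c.1.2 (Fin.last r) ≠ 0} ∩
        {c | c.1.2 (Fin.last r) * c.1.1 0 ≠ c.1.1 (Fin.last r) * c.1.2 0}) :=
    ext fun c => c.toRatMaps_mem_subfamily_zero_iff
  rw [← RatCoeffs.isQuotientMap_toRatMaps.isOpen_preimage, hpre]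
  exact (isOpen_ne_fun (by fun_prop) continuous_const).inter ((isOpen_ne_fun (by fun_prop)
    continuous_const).inter (isOpen_ne_fun (by fun_prop) (by fun_prop)))

lemma dense_subfamily_zero (hr : 1 ≤ r) : Dense (subfamily r 0) := by
  have hpre : Dense (RatCoeffs.toRatMaps ⁻¹' subfamily r 0) := fun c =>
    closure_minimal (fun _ hc => RatCoeffs.mem_closure_preimage_subfamily_zero hr hc)
      isClosed_closure (c.mem_closure_setOf_values_ne hr)
  exact (RatCoeffs.surjective_toRatMaps.denseRange.dense_image
    RatCoeffs.isQuotientMap_toRatMaps.continuous hpre).mono (image_preimage_subset _ _)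

lemma iUnion_subfamily (r : ℕ) : (⋃ j, subfamily r j) = univ := by
  refine eq_univ_of_forall fun R => mem_iUnion.2 ?_
  by_cases h0 : ratMap R.1 ((0 : ℂ) : Sphere) = ∞ <;> by_cases h1 : ratMap R.1 ∞ = ∞
  · exact ⟨3, h0, h1⟩
  · exact ⟨2, .inr ⟨h0, h1⟩⟩
  · exact ⟨2, .inl ⟨h0, h1⟩⟩
  · by_cases h : ratMap R.1 ((0 : ℂ) : Sphere) = ratMap R.1 ∞
    · exact ⟨1, h, h1⟩
    · exact ⟨0, h, h0, h1⟩

lemma Configuration.unique {a₀ a₁ : Sphere} {i j : Fin 4} (hi : Configuration a₀ a₁ i)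
    (hj : Configuration a₀ a₁ j) : i = j := by
  fin_cases i <;> fin_cases j <;> simp_all [Configuration]

lemma disjoint_subfamily (r : ℕ) {i j : Fin 4} (h : i ≠ j) :
    Disjoint (subfamily r i) (subfamily r j) :=
  disjoint_left.2 fun _ hi hj => h (hi.unique hj)

end Family

/-! ### The functions `R(exp(2 π i z / T))` -/

section Psi

variable {R : RatFunc ℂ} {T : ℂ}

lemma exists_ratMap_eq_infty (hR : 1 ≤ ratDegree R) (h : ratMap R ∞ ≠ ∞) :
    ∃ w : ℂ, ratMap R w = ∞ := by
  rw [ratMap_infty, Ne, projPoint_eq_infty_iff] at h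
  have hdeg : 0 < R.denom.natDegree := hR.trans (Polynomial.le_natDegree_of_ne_zero h)
  obtain ⟨w, hw⟩ := Complex.exists_root (Polynomial.natDegree_pos_iff_degree_pos.1 hdeg)
  exact ⟨w, pairMap_eq_infty_iff.2 hw⟩

variable (hT : T ≠ 0) (hR : 1 ≤ ratDegree R)
include hT hR

lemma isRationalOfExp_psi :
    IsRationalOfExp (psi R T) (2 * Real.pi * Complex.I / T) R.num R.denom where
  ne_zero := div_ne_zero Complex.two_pi_I_ne_zero hT
  pair := .num_denom hR
  apply_eq z := by rw [psi, mul_div_right_comm, ratMap_coe]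

lemma isRationalOfExp_psi_neg :
    IsRationalOfExp (psi R T) (-(2 * Real.pi * Complex.I / T))
      (R.num.reflect (ratDegree R)) (R.denom.reflect (ratDegree R)) where
  ne_zero := neg_ne_zero.2 (isRationalOfExp_psi hT hR).ne_zero
  pair := (NonconstantPair.num_denom hR).reflect
  apply_eq z := by
    rw [(isRationalOfExp_psi hT hR).apply_eq, neg_mul, Complex.exp_neg]
    exact (pairMap_reflect_inv (le_max_left _ _) (le_max_right _ _) (Complex.exp_ne_zero _)).symm

lemma periodic_psi : Function.Periodic (psi R T) T := by
  simpa only [div_div_cancel₀ Complex.two_pi_I_ne_zero] using (isRationalOfExp_psi hT hR).periodic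

theorem setOf_isAsymptoticValue_psi :
    {a | IsAsymptoticValue (psi R T) a} = {ratMap R ((0 : ℂ) : Sphere), ratMap R ∞} := by
  rw [(isRationalOfExp_psi hT hR).setOf_isAsymptoticValue (isRationalOfExp_psi_neg hT hR),
    pairMap_reflect_zero, ← ratMap_infty, ratMap_coe]

theorem exists_setOf_isTranscendentalSingularity_psi_eq :
    ∃ U₀ U₁ : Ioi (0 : ℝ) → Set ℂ, U₀ ≠ U₁ ∧
      {s : Sphere × (Ioi (0 : ℝ) → Set ℂ) | IsTranscendentalSingularity (psi R T) s.1 s.2} =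
        {(ratMap R ((0 : ℂ) : Sphere), U₀), (ratMap R ∞, U₁)} := by
  rw [ratMap_infty, ← pairMap_reflect_zero, ratMap_coe]
  exact (isRationalOfExp_psi hT hR).exists_setOf_isTranscendentalSingularity_eq
    (isRationalOfExp_psi_neg hT hR)

theorem isLogarithmic_and_tracts_psi {a : Sphere} {U : Ioi (0 : ℝ) → Set ℂ}
    (hU : IsTranscendentalSingularity (psi R T) a U) :
    IsLogarithmic (psi R T) a U ∧
      (∀ b : ℂ, a = (b : Sphere) → HasHyperbolicTracts b U (field (psi R T))) ∧
      (a = ∞ → HasEllipticTracts U (field (psi R T))) := by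
  obtain ⟨φ, H, c, E, hH⟩ := (isRationalOfExp_psi hT hR)
    |>.exists_logEnd_of_isTranscendentalSingularity (isRationalOfExp_psi_neg hT hR) hU
  refine ⟨E.isLogarithmic hU hH, ?_, ?_⟩
  · rintro b rfl
    exact E.hasHyperbolicTracts hU hH
  · rintro rfl
    exact E.hasEllipticTracts hU hH

theorem accumulatesAtInfty_residueFreeZeros_psi (h0 : ratMap R ((0 : ℂ) : Sphere) ≠ ∞) {w : ℂ}
    {m : ℕ} (hm : 1 ≤ m) (hord : meromorphicOrderAt (fun ζ : ℂ => affine (ratMap R ζ)) w =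
      ((-(m : ℤ) : ℤ) : WithTop ℤ)) :
    AccumulatesAtInfty (residueFreeZeros (field (psi R T)) (m + 1)) := by
  refine (isRationalOfExp_psi hT hR).accumulatesAtInfty_residueFreeZeros ?_ hm hord
  rintro rfl
  refine h0 ((NonconstantPair.num_denom hR).meromorphicOrderAt_affine_pairMap_neg_iff.1 ?_)
  refine hord.trans_lt ?_
  exact_mod_cast neg_lt_zero.2 (Int.natCast_pos.2 hm)

theorem exists_accumulatesAtInfty_residueFreeZeros_psi (h0 : ratMap R ((0 : ℂ) : Sphere) ≠ ∞)
    (h1 : ratMap R ∞ ≠ ∞) :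
    ∃ k : ℕ, 2 ≤ k ∧ AccumulatesAtInfty (residueFreeZeros (field (psi R T)) k) := by
  obtain ⟨w, hw⟩ := exists_ratMap_eq_infty hR h1
  have hneg := (NonconstantPair.num_denom hR).meromorphicOrderAt_affine_pairMap_neg_iff.2 hw
  obtain ⟨n, hn⟩ := WithTop.ne_top_iff_exists.1 hneg.ne_top
  rw [← hn, ← WithTop.coe_zero, WithTop.coe_lt_coe] at hneg
  obtain ⟨m, rfl⟩ : ∃ m : ℕ, n = -m := ⟨n.natAbs, by omega⟩
  have hm : 1 ≤ m := by omega
  exact ⟨m + 1, by omega, accumulatesAtInfty_residueFreeZeros_psi hT hR h0 hm hn.symm⟩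

end Psi

end PeriodicFields

end

open PeriodicFields in
theorem mainTheorem4 (r : ℕ) (hr : 1 ≤ r) (T : ℂ) (hT : T ≠ 0) :
    (∀ R : RatMaps r, ∀ Ψ : ℂ → Sphere, Ψ = psi R.1 T →
      ∀ f : ℂ → ℂ, f = field Ψ → ∀ a₀ : Sphere, a₀ = ratMap R.1 ((0 : ℂ) : Sphere) →
      ∀ a₁ : Sphere, a₁ = ratMap R.1 ∞ →
      -- the vector field is periodic with a unique essential singularity, at infinity
      (Function.Periodic f T ∧ {p : Sphere | IsEssentialSingularity f p} = {∞}) ∧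
      -- exactly two asymptotic values, counted with multiplicity
      ({a : Sphere | IsAsymptoticValue Ψ a} = {a₀, a₁} ∧
        ∃ U₀ U₁ : Ioi (0 : ℝ) → Set ℂ, U₀ ≠ U₁ ∧
          {s : Sphere × (Ioi (0 : ℝ) → Set ℂ) | IsTranscendentalSingularity Ψ s.1 s.2} =
            {(a₀, U₀), (a₁, U₁)}) ∧
      -- both singularities are logarithmic, with hyperbolic or elliptic tracts
      (∀ (a : Sphere) (U : Ioi (0 : ℝ) → Set ℂ), IsTranscendentalSingularity Ψ a U →
        IsLogarithmic Ψ a U ∧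
        (∀ b : ℂ, a = (b : Sphere) → HasHyperbolicTracts b U f) ∧
        (a = ∞ → HasEllipticTracts U f)) ∧
      -- poles of the vector field
      ((∃ w : ℂ, w ≠ 0 ∧ IsCriticalPoint (fun ζ : ℂ => ratMap R.1 (ζ : Sphere)) w ∧
          ratMap R.1 (w : Sphere) ≠ ∞) → AccumulatesAtInfty (poles f)) ∧
      -- zeros of the vector field
      (¬ IsAsymptoticValue Ψ ∞ →
        (∃ k : ℕ, 2 ≤ k ∧ AccumulatesAtInfty (residueFreeZeros f k)) ∧
        ∀ (w : ℂ) (m : ℕ), 1 ≤ m →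
          meromorphicOrderAt (fun ζ : ℂ => affine (ratMap R.1 (ζ : Sphere))) w =
            ((-(m : ℤ) : ℤ) : WithTop ℤ) →
          AccumulatesAtInfty (residueFreeZeros f (m + 1)))) ∧
    -- the four subfamilies, the first of which is generic
    ((⋃ j, subfamily r j) = univ ∧ (∀ i j, i ≠ j → Disjoint (subfamily r i) (subfamily r j)) ∧
      IsOpen (subfamily r 0) ∧ Dense (subfamily r 0)) := by
  refine ⟨?_, iUnion_subfamily r, fun i j h => disjoint_subfamily r h, isOpen_subfamily_zero r,
    dense_subfamily_zero hr⟩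
  rintro ⟨R, rfl⟩ _ rfl _ rfl _ rfl _ rfl
  have S := isRationalOfExp_psi hT hr
  have hasymp := setOf_isAsymptoticValue_psi hT hr
  refine ⟨⟨periodic_field (periodic_psi hT hr), S.setOf_isEssentialSingularity_field⟩,
    ⟨hasymp, exists_setOf_isTranscendentalSingularity_psi_eq hT hr⟩,
    fun _ _ => isLogarithmic_and_tracts_psi hT hr, ?_, fun hinf => ?_⟩
  · rintro ⟨w, hw, hcrit, hfin⟩
    exact S.accumulatesAtInfty_poles hw hcrit hfin
  · have h0 : ratMap R ((0 : ℂ) : Sphere) ≠ ∞ := fun h => hinf (hasymp.symm.subset (.inl h.symm))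
    have h1 : ratMap R ∞ ≠ ∞ := fun h => hinf (hasymp.symm.subset (.inr h.symm))
    exact ⟨exists_accumulatesAtInfty_residueFreeZeros_psi hT hr h0 h1,
      fun _ _ => accumulatesAtInfty_residueFreeZeros_psi hT hr h0⟩
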